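/- Theorem. Let $\omega>0$, $v\in\mathbb R$ with $|v|<1$, and $1<p<5$. Let $|D_y|=\sqrt{-\partial_{yy}}$ and let $$X=H^1_xL^2_y(\mathbb R^2)\cap L^2_xH^{1/2}_y(\mathbb R^2)=\{u\in L^2(\mathbb R^2;\mathbb C):\ \partial_xu\in L^2,\ |D_y|^{1/2}u\in L^2\}.$$ For $u\in X$ put $$\mathcal A_{\omega,v}(u)=\int_{\mathbb R^2}\Big\{|\partial_xu|^2+|D_y|u\,\overline u-iv\,\partial_yu\,\overline u+\omega|u|^2\Big\}\,dx\,dy,$$ $$\mathcal S_{\omega,v}(u)=\tfrac12\mathcal A_{\omega,v}(u)-\tfrac1{p+1}\int_{\mathbb R^2}|u|^{p+1}\,dx\,dy,\qquad \mathcal N_{\omega,v}(u)=\mathcal A_{\omega,v}(u)-\int_{\mathbb R^2}|u|^{p+1}\,dx\,dy,$$ where the terms $|D_y|u\,\overline u$ and $\partial_yu\,\overline u$ are understood as duality pairings (defined through the Fourier transform), and put $$m_{\omega,v}=\inf\{\mathcal S_{\omega,v}(u):\ u\in X\setminus\{0\},\ \mathcal N_{\omega,v}(u)=0\}.$$ A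 function $u\in X$ is called a solution of $$-\partial_{xx}u+|D_y|u-iv\,\partial_yu+\omega u-|u|^{p-1}u=0\quad\text{in }\mathbb R^2\qquad(\ast)$$ if the equation holds in the dual of $X$, that is, when tested against every $w\in X$. Then $X\subset L^{p+1}(\mathbb R^2)$ (so that $\mathcal S_{\omega,v}$ and $\mathcal N_{\omega,v}$ are well defined on $X$), the infimum $m_{\omega,v}$ is taken over a set of real numbers that is bounded below, and there exists a solution $Q_{\omega,v}\in X\setminus\{0\}$ of $(\ast)$ with $$\mathcal N_{\omega,v}(Q_{\omega,v})=0,\qquad \mathcal S_{\omega,v}(Q_{\omega,v})=m_{\omega,v}.$$ Moreover, $Q_{\omega,v}$ is a ground state: $\mathcal S_{\omega,v}(Q_{\omega,v})\le\mathcal S_{\omega,v}(u)$ for every solution $u\in X\setminus\{0\}$ of $(\ast)$. -/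

import Mathlib

open MeasureTheory FourierTransform
open scoped ComplexConjugate ENNReal

namespace HalfWave

noncomputable section

/-- The plane; the coordinate `0` is `x` and the coordinate `1` is `y`. -/
abbrev Plane : Type := EuclideanSpace ℝ (Fin 2)

/-- Complex valued square integrable functions on the plane, modulo equality almost everywhere.
On this space `𝓕` is the `L²` Fourier transform, with kernel `exp (-2 π i ⟪z, k⟫)`. -/
abbrev L2 : Type := Lp ℂ 2 (volume : Measure Plane)

/-- The `L²` domain of the Fourier multiplier with symbol `m`. -/
abbrev MemMultiplierDomain (m : Plane → ℂ) (u : L2) : Prop :=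
  MemLp (fun k => m k * (𝓕 u : L2) k) 2 (volume : Measure Plane)

open Classical in
/-- The Fourier multiplier with symbol `m` applied to `u`, that is, the `L²` function with Fourier
transform `m * 𝓕 u`. It is only used on the domain. -/
def multiplier (m : Plane → ℂ) (u : L2) : L2 :=
  if h : MemMultiplierDomain m u then (𝓕⁻ (MemLp.toLp _ h : L2) : L2) else 0

/-- The symbol of `∂_x`. -/
def symbolDx (k : Plane) : ℂ := 2 * Real.pi * Complex.I * (k 0 : ℂ)

/-- The symbol of `|D_y|^{1/2}`. -/
def symbolAbsDyHalf (k : Plane) : ℂ := (Real.sqrt (2 * Real.pi * |k 1|) : ℂ)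

/-- The symbol of `|D_y|`. -/
def symbolAbsDy (k : Plane) : ℂ := ((2 * Real.pi * |k 1| : ℝ) : ℂ)

/-- The symbol of `-i ∂_y`. -/
def symbolNegIDy (k : Plane) : ℂ := ((2 * Real.pi * k 1 : ℝ) : ℂ)

/-- The energy space `X = H¹_x L²_y ∩ L²_x H^{1/2}_y`. -/
def X : Set L2 :=
  {u | MemMultiplierDomain symbolDx u ∧ MemMultiplierDomain symbolAbsDyHalf u}

/-- The partial derivative `∂_x u` of `u ∈ X`, an `L²` function. -/
def dx (u : L2) : L2 := multiplier symbolDx u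

/-- The duality pairing `∫ (m(D) u) * conj w`, written on the Fourier side. If `|m k| ≤ C |k 1|`
and `u, w ∈ X`, it converges absolutely (even when `m(D) u` is not a function). -/
def pairing (m : Plane → ℂ) (u w : L2) : ℂ :=
  ∫ k : Plane, m k * (𝓕 u : L2) k * conj ((𝓕 w : L2) k)

/-- The sesquilinear form
`∫ ∂_x u conj(∂_x w) + |D_y| u conj(w) - i v ∂_y u conj(w) + ω u conj(w)`. -/
def energyForm (ω v : ℝ) (u w : L2) : ℂ :=
  (∫ z : Plane, dx u z * conj (dx w z)) + pairing symbolAbsDy u w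
    + (v : ℂ) * pairing symbolNegIDy u w + (ω : ℂ) * ∫ z : Plane, u z * conj (w z)

/-- The action functional `S_{ω,v}`. (The quantity `energyForm ω v u u` is real for `u ∈ X`.) -/
def action (ω v p : ℝ) (u : L2) : ℝ :=
  1 / 2 * (energyForm ω v u u).re - 1 / (p + 1) * ∫ z : Plane, ‖u z‖ ^ (p + 1)

/-- The Nehari functional `N_{ω,v}`. -/
def nehari (ω v p : ℝ) (u : L2) : ℝ :=
  (energyForm ω v u u).re - ∫ z : Plane, ‖u z‖ ^ (p + 1)

/-- The values of the action on the Nehari set `{u ∈ X \ {0} | N_{ω,v}(u) = 0}`. -/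
def nehariValues (ω v p : ℝ) : Set ℝ :=
  {s | ∃ u ∈ X, u ≠ 0 ∧ nehari ω v p u = 0 ∧ action ω v p u = s}

/-- The minimal value `m_{ω,v}`. -/
def minAction (ω v p : ℝ) : ℝ := sInf (nehariValues ω v p)

/-- `u ∈ X` is a solution of
`-∂_xx u + |D_y| u - i v ∂_y u + ω u - |u|^{p-1} u = 0`:
the equation holds in the dual of `X`, i.e. tested against every `w ∈ X`. -/
def IsSolution (ω v p : ℝ) (u : L2) : Prop :=
  u ∈ X ∧ ∀ w ∈ X,
    energyForm ω v u w - ∫ z : Plane, ((‖u z‖ ^ (p - 1) : ℝ) : ℂ) * u z * conj (w z) = 0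

end

end HalfWave

/-! ### Multiplication operators and frequency cut-offs on `L2` -/

namespace HalfWave

noncomputable section

/-! The map `T`, division by the square root of the symbol on the Fourier side, turns the energy
form into the `L²` inner product and maps `L2` onto `X` (`energyForm_T`, `exists_T_eq`). On the
Nehari set the action is a positive multiple of `‖f‖ ^ 2`, where `u = T f`. The problem thus reduces
to showing that, with `q = p + 1`, the best constant in `∫ |T g|^q ≤ best * ‖g‖^q` is finite and
attained: a maximizer, suitably scaled, solves the equation and has the least norm allowed on the
Nehari set. Solutions lie on the Nehari set, so it is also a ground state.

Finiteness: the set where the symbol is at most `R` has area `O(R^(3/2))`. Bernstein's inequality on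
dyadic shells, interpolated with Plancherel, gives a convergent geometric series exactly when `q <
6` (`exists_eLpNorm_T_le`).

Attainment: the high frequency tail is uniformly small, so a function with non-negligible `L^q` norm
has a low frequency part that is large at some point (`exists_le_norm_ev`). Translating these points
to the origin gives a maximizing sequence with nonzero weak limit `g'`. Along a subsequence the
images under `T` converge almost everywhere, and the Brezis–Lieb lemma splits the `L^q` mass while
the Hilbert norm splits too. With `s = ‖g'‖ ^ 2` this yields `1 ≤ s^(q/2) + (1-s)^(q/2)`, and strict
superadditivity of the power `q/2 > 1` forces `s = 1`, so nothing is lost in the limit. -/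

/-- Bounded measurable symbols. -/
structure BddSymbol where
  toFun : Plane → ℂ
  measurable' : Measurable toFun
  bound' : ∃ C : ℝ, ∀ k, ‖toFun k‖ ≤ C

instance : CoeFun BddSymbol fun _ => Plane → ℂ := ⟨BddSymbol.toFun⟩

theorem BddSymbol.memLp (m : BddSymbol) (g : L2) : MemLp (fun k => m k * g k) 2 volume := by
  obtain ⟨C, hC⟩ := m.bound'
  refine (Lp.memLp g).of_le_mul (c := C)
    (m.measurable'.aestronglyMeasurable.mul (Lp.aestronglyMeasurable g)) ?_
  refine Filter.Eventually.of_forall fun k => ?_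
  rw [norm_mul]
  exact mul_le_mul_of_nonneg_right (hC k) (norm_nonneg _)

/-- Multiplication by a bounded symbol, as an operator on `L²`. -/
def mulOp (m : BddSymbol) : L2 →L[ℂ] L2 :=
  LinearMap.mkContinuousOfExistsBound
    { toFun := fun g => (m.memLp g).toLp _
      map_add' := fun f g => by
        rw [← MemLp.toLp_add]
        refine MemLp.toLp_congr _ _ ?_
        filter_upwards [Lp.coeFn_add f g] with k hk
        simp only [hk, Pi.add_apply]
        ring
      map_smul' := fun c f => by
        rw [RingHom.id_apply, ← MemLp.toLp_const_smul]
        refine MemLp.toLp_congr _ _ ?_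
        filter_upwards [Lp.coeFn_smul c f] with k hk
        simp only [hk, Pi.smul_apply, smul_eq_mul]
        ring }
    (by
      obtain ⟨C, hC⟩ := m.bound'
      refine ⟨C, fun g => ?_⟩
      refine Lp.norm_le_mul_norm_of_ae_le_mul ?_
      filter_upwards [(m.memLp g).coeFn_toLp] with k hk
      simp only [LinearMap.coe_mk, AddHom.coe_mk, hk, norm_mul]
      exact mul_le_mul_of_nonneg_right (hC k) (norm_nonneg _))

theorem coeFn_mulOp (m : BddSymbol) (g : L2) : mulOp m g =ᵐ[volume] fun k => m k * g k :=
  (m.memLp g).coeFn_toLp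

theorem norm_mulOp_le {m : BddSymbol} {g : L2} {C : ℝ} (h : ∀ᵐ k, ‖m k * g k‖ ≤ C * ‖g k‖) :
    ‖mulOp m g‖ ≤ C * ‖g‖ := by
  refine Lp.norm_le_mul_norm_of_ae_le_mul ?_
  filter_upwards [coeFn_mulOp m g, h] with k hk h
  rwa [hk]

open Classical in
/-- The indicator of a measurable set, as a bounded symbol. -/
def cutSymbol (E : Set Plane) : BddSymbol where
  -- The zero value on nonmeasurable sets lets `cut` be defined without a measurability argument.
  toFun := if MeasurableSet E then E.indicator 1 else 0
  measurable' := by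
    split_ifs with h
    · exact measurable_one.indicator h
    · exact measurable_zero
  bound' := by
    refine ⟨1, fun k => ?_⟩
    split_ifs with h
    · by_cases hk : k ∈ E <;> simp [hk]
    · simp

theorem cutSymbol_apply {E : Set Plane} (hE : MeasurableSet E) (k : Plane) :
    cutSymbol E k = E.indicator 1 k := by
  simp [cutSymbol, hE]

/-- Restriction to a measurable set, as an operator on `L²`. -/
def cut (E : Set Plane) : L2 →L[ℂ] L2 := mulOp (cutSymbol E)

theorem coeFn_cut {E : Set Plane} (hE : MeasurableSet E) (g : L2) :
    cut E g =ᵐ[volume] E.indicator g := by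
  filter_upwards [coeFn_mulOp (cutSymbol E) g] with k hk
  rw [cut, hk, cutSymbol_apply hE]
  by_cases h : k ∈ E <;> simp [h]

theorem cut_add_cut {E F : Set Plane} (hE : MeasurableSet E) (hF : MeasurableSet F)
    (h : Disjoint E F) (g : L2) : cut E g + cut F g = cut (E ∪ F) g := by
  refine Lp.ext ?_
  filter_upwards [Lp.coeFn_add (cut E g) (cut F g), coeFn_cut hE g, coeFn_cut hF g,
    coeFn_cut (hE.union hF) g] with k h1 h2 h3 h4
  rw [h1, h4, Pi.add_apply, h2, h3, Set.indicator_union_of_disjoint h]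

theorem cut_univ (g : L2) : cut Set.univ g = g := by
  refine Lp.ext ?_
  filter_upwards [coeFn_cut MeasurableSet.univ g] with k hk
  rw [hk, Set.indicator_univ]

/-! ### The symbol and the parametrization of the energy space -/

/-- The parameters `ω > 0` and `|v| < 1`. -/
structure Params where
  ω : ℝ
  v : ℝ
  ω_pos : 0 < ω
  abs_v_lt : |v| < 1

namespace Params

variable (P : Params)

/-- The symbol of `-∂_xx + |D_y| - i v ∂_y + ω`. -/
def symb (k : Plane) : ℝ :=
  (2 * Real.pi * k 0) ^ 2 + 2 * Real.pi * |k 1| + P.v * (2 * Real.pi * k 1) + P.ω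

/-- The drift is absorbed by the `|k 1|` term, leaving the factor `1 - |v|`, which the assumption on
`v` makes positive. The lower bounds on the symbol used later rest on this. -/
theorem symb_ge (k : Plane) :
    (2 * Real.pi * k 0) ^ 2 + (1 - |P.v|) * (2 * Real.pi * |k 1|) + P.ω ≤ P.symb k := by
  have h : -(|P.v| * |k 1|) ≤ P.v * k 1 := by rw [← abs_mul]; exact neg_abs_le _
  have := mul_le_mul_of_nonneg_left h Real.two_pi_pos.le
  unfold symb
  nlinarith

theorem ω_le_symb (k : Plane) : P.ω ≤ P.symb k := by
  have h := P.symb_ge k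
  have h1 : 0 ≤ (1 - |P.v|) * (2 * Real.pi * |k 1|) :=
    mul_nonneg (by linarith [P.abs_v_lt]) (by positivity)
  nlinarith [sq_nonneg (2 * Real.pi * k 0)]

theorem symb_pos (k : Plane) : 0 < P.symb k := P.ω_pos.trans_le (P.ω_le_symb k)

theorem continuous_symb : Continuous P.symb := by
  unfold symb
  fun_prop

theorem measurable_symb : Measurable P.symb := P.continuous_symb.measurable

/-- The symbol `symb ^ (-1/2)`. -/
def invSqrt : BddSymbol where
  toFun k := (((√(P.symb k))⁻¹ : ℝ) : ℂ)
  measurable' := by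
    have := P.measurable_symb
    fun_prop
  bound' := by
    refine ⟨(√P.ω)⁻¹, fun k => ?_⟩
    rw [Complex.norm_real, Real.norm_of_nonneg (by positivity)]
    exact inv_anti₀ (Real.sqrt_pos.2 P.ω_pos) (Real.sqrt_le_sqrt (P.ω_le_symb k))

theorem invSqrt_apply (k : Plane) : P.invSqrt k = (((√(P.symb k))⁻¹ : ℝ) : ℂ) := rfl

theorem norm_invSqrt (k : Plane) : ‖P.invSqrt k‖ = (√(P.symb k))⁻¹ := by
  rw [invSqrt_apply, Complex.norm_real, Real.norm_of_nonneg (by positivity)]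

/-- The map `g ↦ 𝓕⁻¹ (symb ^ (-1/2) * g)`, an isometry of `L²` onto the energy space with the
energy norm. -/
def T : L2 →L[ℂ] L2 :=
  ((Lp.fourierTransformₗᵢ Plane ℂ).symm.toContinuousLinearEquiv : L2 →L[ℂ] L2).comp
    (mulOp P.invSqrt)

theorem T_apply (g : L2) : P.T g = 𝓕⁻ (mulOp P.invSqrt g) := rfl

theorem fourier_T (g : L2) : 𝓕 (P.T g) = mulOp P.invSqrt g := by
  rw [T_apply, FourierTransform.fourier_fourierInv_eq]

theorem coeFn_fourier_T (g : L2) : (𝓕 (P.T g) : L2) =ᵐ[volume] fun k => P.invSqrt k * g k := by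
  rw [fourier_T]
  exact coeFn_mulOp _ _

theorem norm_fourierInv (f : L2) : ‖(𝓕⁻ f : L2)‖ = ‖f‖ :=
  (Lp.fourierTransformₗᵢ Plane ℂ).symm.norm_map f

/-- Plancherel, since the multiplier is at most `r ^ (-1/2)` on the support of `g`. -/
theorem norm_T_le_of_symb_ge {g : L2} {r : ℝ} (hr : 0 < r) (h : ∀ᵐ k, g k ≠ 0 → r ≤ P.symb k) :
    ‖P.T g‖ ≤ (√r)⁻¹ * ‖g‖ := by
  rw [T_apply, norm_fourierInv]
  refine norm_mulOp_le ?_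
  filter_upwards [h] with k hk
  by_cases h0 : g k = 0
  · simp [h0]
  rw [norm_mul, norm_invSqrt]
  refine mul_le_mul_of_nonneg_right ?_ (norm_nonneg _)
  exact inv_anti₀ (Real.sqrt_pos.2 hr) (Real.sqrt_le_sqrt (hk h0))

theorem norm_T_le (g : L2) : ‖P.T g‖ ≤ (√P.ω)⁻¹ * ‖g‖ :=
  P.norm_T_le_of_symb_ge P.ω_pos (Filter.Eventually.of_forall fun k _ => P.ω_le_symb k)

theorem T_injective : Function.Injective P.T := by
  intro f g h
  have h' : mulOp P.invSqrt f = mulOp P.invSqrt g := by rw [← fourier_T, ← fourier_T, h]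
  refine Lp.ext ?_
  have h1 := coeFn_mulOp P.invSqrt f
  rw [h'] at h1
  filter_upwards [h1, coeFn_mulOp P.invSqrt g] with k h1 h2
  rw [h1] at h2
  refine mul_left_cancel₀ ?_ h2
  rw [invSqrt_apply]
  exact_mod_cast (inv_pos.2 (Real.sqrt_pos.2 (P.symb_pos k))).ne'

theorem memMultiplierDomain_T {m : Plane → ℂ} (hm : Measurable m) {C : ℝ} (hC : 0 ≤ C)
    (h : ∀ k, ‖m k‖ ^ 2 ≤ C * P.symb k) (g : L2) : MemMultiplierDomain m (P.T g) := by
  refine (Lp.memLp g).of_le_mul (c := √C)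
    (hm.aestronglyMeasurable.mul (Lp.aestronglyMeasurable _)) ?_
  filter_upwards [P.coeFn_fourier_T g] with k hk
  rw [hk, ← mul_assoc, norm_mul, norm_mul, norm_invSqrt]
  refine mul_le_mul_of_nonneg_right ?_ (norm_nonneg _)
  rw [← div_eq_mul_inv, div_le_iff₀ (Real.sqrt_pos.2 (P.symb_pos k)), ← Real.sqrt_mul hC]
  exact Real.le_sqrt_of_sq_le (h k)

theorem norm_symbolDx_sq (k : Plane) : ‖symbolDx k‖ ^ 2 = (2 * Real.pi * k 0) ^ 2 := by
  simp [symbolDx, mul_pow, abs_of_pos Real.pi_pos]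

theorem norm_symbolAbsDyHalf_sq (k : Plane) : ‖symbolAbsDyHalf k‖ ^ 2 = 2 * Real.pi * |k 1| := by
  rw [symbolAbsDyHalf, Complex.norm_real, Real.norm_of_nonneg (by positivity),
    Real.sq_sqrt (by positivity)]

theorem measurable_symbolDx : Measurable symbolDx := by
  unfold symbolDx; fun_prop

theorem measurable_symbolAbsDyHalf : Measurable symbolAbsDyHalf := by
  unfold symbolAbsDyHalf; fun_prop

theorem T_mem_X (g : L2) : P.T g ∈ X := by
  have hv : 0 < 1 - |P.v| := by linarith [P.abs_v_lt]
  constructor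
  · refine P.memMultiplierDomain_T measurable_symbolDx zero_le_one (fun k => ?_) g
    rw [norm_symbolDx_sq]
    have := P.symb_ge k
    have : 0 ≤ (1 - |P.v|) * (2 * Real.pi * |k 1|) := by positivity
    linarith [P.ω_pos]
  · refine P.memMultiplierDomain_T measurable_symbolAbsDyHalf (inv_nonneg.2 hv.le) (fun k => ?_) g
    rw [norm_symbolAbsDyHalf_sq, inv_mul_eq_div, le_div_iff₀ hv]
    have := P.symb_ge k
    nlinarith [P.ω_pos, sq_nonneg (2 * Real.pi * k 0)]

theorem symb_le (k : Plane) :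
    P.symb k ≤ ‖symbolDx k‖ ^ 2 + 2 * ‖symbolAbsDyHalf k‖ ^ 2 + P.ω := by
  rw [norm_symbolDx_sq, norm_symbolAbsDyHalf_sq]
  have h : P.v * k 1 ≤ |P.v| * |k 1| := by rw [← abs_mul]; exact le_abs_self _
  have h2 : |P.v| * |k 1| ≤ |k 1| := mul_le_of_le_one_left (abs_nonneg _) P.abs_v_lt.le
  have := mul_le_mul_of_nonneg_left (h.trans h2) Real.two_pi_pos.le
  unfold symb
  nlinarith

/-- The preimage is `√symb * 𝓕 u`. It is square integrable because `√symb` is at most a combination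
of the moduli of the two symbols defining `X` and a constant. -/
theorem exists_T_eq {u : L2} (hu : u ∈ X) : ∃ g, P.T g = u := by
  have hmem : MemLp (fun k => ((√(P.symb k) : ℝ) : ℂ) * (𝓕 u : L2) k) 2 volume := by
    have h3 : MemLp (fun k => ‖symbolDx k * (𝓕 u : L2) k‖ + 2 * ‖symbolAbsDyHalf k * (𝓕 u : L2) k‖
        + √P.ω * ‖(𝓕 u : L2) k‖) 2 volume :=
      (hu.1.norm.add (hu.2.norm.const_mul 2)).add ((Lp.memLp (𝓕 u : L2)).norm.const_mul _)
    refine h3.of_le ?_ (Filter.Eventually.of_forall fun k => ?_)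
    · have := P.measurable_symb
      exact AEStronglyMeasurable.mul (by fun_prop) (Lp.aestronglyMeasurable _)
    · rw [norm_mul, Complex.norm_real, Real.norm_of_nonneg (by positivity)]
      refine le_trans ?_ (le_abs_self _)
      rw [norm_mul, norm_mul, ← mul_assoc, ← add_mul, ← add_mul]
      refine mul_le_mul_of_nonneg_right ?_ (norm_nonneg _)
      refine Real.sqrt_le_iff.2 ⟨by positivity, (P.symb_le k).trans ?_⟩
      have h1 := norm_nonneg (symbolDx k)
      have h2 := norm_nonneg (symbolAbsDyHalf k)
      have h3 := Real.sqrt_nonneg P.ω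
      have h4 := Real.sq_sqrt P.ω_pos.le
      nlinarith [mul_nonneg h1 h2, mul_nonneg h1 h3, mul_nonneg h2 h3]
  refine ⟨hmem.toLp _, ?_⟩
  have : (𝓕 (P.T (hmem.toLp _)) : L2) = 𝓕 u := by
    refine Lp.ext ?_
    filter_upwards [P.coeFn_fourier_T (hmem.toLp _), hmem.coeFn_toLp] with k h1 h2
    rw [h1, h2, invSqrt_apply, ← mul_assoc, ← Complex.ofReal_mul,
      inv_mul_cancel₀ (Real.sqrt_pos.2 (P.symb_pos k)).ne', Complex.ofReal_one, one_mul]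
  exact (Lp.fourierTransformₗᵢ Plane ℂ).injective this

theorem inner_L2 (f g : L2) : inner ℂ f g = ∫ z, g z * conj (f z) := by
  rw [L2.inner_def]
  rfl

theorem integrable_mul_conj (f g : L2) : Integrable (fun z => g z * conj (f z)) := by
  have := L2.integrable_inner (𝕜 := ℂ) f g
  exact this

theorem integral_dx {u w : L2} (hu : u ∈ X) (hw : w ∈ X) :
    ∫ z, dx u z * conj (dx w z) =
      ∫ k, ‖symbolDx k‖ ^ 2 * ((𝓕 u : L2) k * conj ((𝓕 w : L2) k)) := by
  rw [← inner_L2, dx, dx, multiplier, multiplier, dif_pos hu.1, dif_pos hw.1,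
    ← Lp.inner_fourier_eq, FourierTransform.fourier_fourierInv_eq,
    FourierTransform.fourier_fourierInv_eq, inner_L2]
  refine integral_congr_ae ?_
  filter_upwards [hu.1.coeFn_toLp, hw.1.coeFn_toLp] with k h1 h2
  rw [h1, h2, map_mul, ← Complex.mul_conj']
  ring

/-- The two factors `symb ^ (-1/2)` compensate the growth of `m`, and what remains is dominated by
`C * ‖f‖ * ‖g‖`. -/
theorem integrable_mul_of_norm_le {m : Plane → ℂ} (hm : Measurable m) {C : ℝ}
    (h : ∀ k, ‖m k‖ ≤ C * P.symb k) (f g : L2) :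
    Integrable (fun k => m k * ((𝓕 (P.T f) : L2) k * conj ((𝓕 (P.T g) : L2) k))) := by
  refine ((integrable_mul_conj g f).norm.const_mul C).mono'
    (hm.aestronglyMeasurable.mul ((Lp.aestronglyMeasurable _).mul
      (Complex.continuous_conj.comp_aestronglyMeasurable (Lp.aestronglyMeasurable _)))) ?_
  filter_upwards [P.coeFn_fourier_T f, P.coeFn_fourier_T g] with k h1 h2
  rw [h1, h2]
  simp only [norm_mul, map_mul, RCLike.norm_conj, norm_invSqrt]
  have hs := P.symb_pos k
  have h3 : (√(P.symb k))⁻¹ * (√(P.symb k))⁻¹ = (P.symb k)⁻¹ := by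
    rw [← mul_inv, Real.mul_self_sqrt hs.le]
  calc ‖m k‖ * ((√(P.symb k))⁻¹ * ‖f k‖ * ((√(P.symb k))⁻¹ * ‖g k‖))
      = ‖m k‖ * (P.symb k)⁻¹ * (‖f k‖ * ‖g k‖) := by rw [← h3]; ring
    _ ≤ C * (‖f k‖ * ‖g k‖) := by
        refine mul_le_mul_of_nonneg_right ?_ (by positivity)
        rw [← div_eq_mul_inv, div_le_iff₀ hs]
        exact h k

/-- On the Fourier side the four terms add up to multiplication by `symb`, which the two factors
`symb ^ (-1/2)` cancel. The integrability statements allow the integrals to be merged. -/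
theorem energyForm_T (f g : L2) : energyForm P.ω P.v (P.T f) (P.T g) = inner ℂ g f := by
  have hv : 0 < 1 - |P.v| := by linarith [P.abs_v_lt]
  have hAbs : ∀ k : Plane, 2 * Real.pi * |k 1| ≤ (1 - |P.v|)⁻¹ * P.symb k := fun k => by
    rw [inv_mul_eq_div, le_div_iff₀ hv]
    have := P.symb_ge k
    nlinarith [P.ω_pos, sq_nonneg (2 * Real.pi * k 0)]
  have i1 := P.integrable_mul_of_norm_le (m := fun k => (‖symbolDx k‖ : ℂ) ^ 2) (C := 1)
    (by have := measurable_symbolDx; fun_prop) (fun k => by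
      rw [norm_pow, Complex.norm_real, norm_norm, norm_symbolDx_sq]
      have := P.symb_ge k
      have : 0 ≤ (1 - |P.v|) * (2 * Real.pi * |k 1|) := by positivity
      linarith [P.ω_pos]) f g
  have i2 := P.integrable_mul_of_norm_le (m := symbolAbsDy) (by unfold symbolAbsDy; fun_prop)
    (fun k => by
      rw [symbolAbsDy, Complex.norm_real, Real.norm_of_nonneg (by positivity)]
      exact hAbs k) f g
  have i3 := P.integrable_mul_of_norm_le (m := symbolNegIDy) (by unfold symbolNegIDy; fun_prop)
    (fun k => by
      rw [symbolNegIDy, Complex.norm_real, Real.norm_eq_abs, abs_mul,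
        abs_of_pos Real.two_pi_pos]
      exact hAbs k) f g
  have i4 := integrable_mul_conj (𝓕 (P.T g)) (𝓕 (P.T f))
  rw [energyForm, integral_dx (P.T_mem_X f) (P.T_mem_X g), pairing, pairing, ← inner_L2 (P.T g),
    ← Lp.inner_fourier_eq (P.T g), inner_L2, inner_L2]
  have i12 := i1.add i2
  have i123 := i12.add (i3.const_mul (P.v : ℂ))
  simp only [Pi.add_def] at i12 i123
  simp only [mul_assoc]
  rw [← integral_const_mul, ← integral_const_mul, ← integral_add i1 i2,
    ← integral_add i12 (i3.const_mul _), ← integral_add i123 (i4.const_mul _)]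
  refine integral_congr_ae ?_
  filter_upwards [P.coeFn_fourier_T f, P.coeFn_fourier_T g] with k h1 h2
  rw [h1, h2, invSqrt_apply, symbolAbsDy, symbolNegIDy, ← Complex.ofReal_pow, norm_symbolDx_sq]
  have hs := P.symb_pos k
  have h3 : (√(P.symb k))⁻¹ * (√(P.symb k))⁻¹ * P.symb k = 1 := by
    rw [← mul_inv, Real.mul_self_sqrt hs.le, inv_mul_cancel₀ hs.ne']
  have h4 : ((((√(P.symb k))⁻¹ * (√(P.symb k))⁻¹ * P.symb k : ℝ)) : ℂ) = 1 := by
    rw [h3, Complex.ofReal_one]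
  rw [map_mul, Complex.conj_ofReal]
  calc _ = ((((√(P.symb k))⁻¹ * (√(P.symb k))⁻¹ * P.symb k : ℝ)) : ℂ) * (f k * conj (g k)) := by
        rw [symb]; push_cast; ring
    _ = _ := by rw [h4, one_mul]

end Params

/-! ### The inverse Fourier transform as an integral, Bernstein's inequality, interpolation -/

theorem integral_fourierInv_smul_eq {φ f : Plane → ℂ} (hφ : Integrable φ) (hf : Integrable f) :
    ∫ k, 𝓕⁻ φ k • f k = ∫ z, φ z • 𝓕⁻ f z := by
  have := VectorFourier.integral_fourierIntegral_smul_eq_flip (e := Real.fourierChar)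
    (L := -innerₗ Plane) (μ := volume) (ν := volume) Real.continuous_fourierChar
    (by
      have : (fun p : Plane × Plane => (-innerₗ Plane) p.1 p.2)
        = fun p : Plane × Plane => -inner ℝ p.1 p.2 := by ext p; simp
      rw [this]
      fun_prop) hφ hf
  have hflip : (-innerₗ Plane).flip = -innerₗ Plane := by
    ext x y
    simp [real_inner_comm]
  rw [hflip] at this
  exact this

theorem continuous_fourierInv {f : Plane → ℂ} (hf : Integrable f) : Continuous (𝓕⁻ f) := by
  refine VectorFourier.fourierIntegral_continuous Real.continuous_fourierChar ?_ hf
  have : (fun p : Plane × Plane => (-innerₗ Plane) p.1 p.2)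
    = fun p : Plane × Plane => -inner ℝ p.1 p.2 := by ext p; simp
  rw [this]
  fun_prop

/-- On `L¹ ∩ L²` the inverse Fourier transform is given by the integral. -/
theorem coeFn_fourierInv_of_integrable (f : L2) (hf : Integrable f) :
    (𝓕⁻ f : L2) =ᵐ[volume] 𝓕⁻ (f : Plane → ℂ) := by
  -- It suffices to test against smooth compactly supported functions. These are Schwartz, so the
  -- transform can be moved onto them through tempered distributions on one side and Fubini on the
  -- other.
  refine ae_eq_of_integral_contDiff_smul_eq ((Lp.memLp _).locallyIntegrable (by norm_num))
    (continuous_fourierInv hf).locallyIntegrable fun φ hφ hφc => ?_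
  have hc : HasCompactSupport (fun z => (φ z : ℂ)) := hφc.comp_left Complex.ofReal_zero
  have hs : ContDiff ℝ (↑(⊤ : ℕ∞)) (fun z => (φ z : ℂ)) :=
    Complex.ofRealCLM.contDiff.comp hφ
  let ψ : SchwartzMap Plane ℂ := hc.toSchwartzMap hs
  have hψ : ∀ z, ψ z = (φ z : ℂ) := fun z => rfl
  have h1 := congrArg (fun t => t ψ) (Lp.fourierInv_toTemperedDistribution_eq f)
  simp only [TemperedDistribution.fourierInv_apply, Lp.toTemperedDistribution_apply] at h1
  have h2 : ∫ z, ψ z • (𝓕⁻ f : L2) z = ∫ z, ψ z • 𝓕⁻ (f : Plane → ℂ) z := by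
    rw [← h1, SchwartzMap.fourierInv_coe, integral_fourierInv_smul_eq ψ.integrable hf]
  simpa only [hψ, Complex.real_smul, smul_eq_mul] using h2

theorem integrable_cut {E : Set Plane} (hE : MeasurableSet E) (hV : volume E ≠ ∞) (f : L2) :
    Integrable (cut E f) := by
  rw [integrable_congr (coeFn_cut hE f), integrable_indicator_iff hE]
  have : Fact (volume E < ∞) := ⟨hV.lt_top⟩
  exact ((Lp.memLp f).restrict E).integrable (by norm_num)

theorem integral_norm_cut_le {E : Set Plane} (hE : MeasurableSet E) {V : ℝ} (hV0 : 0 ≤ V)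
    (hV : volume E ≤ ENNReal.ofReal V) (f : L2) : ∫ k, ‖cut E f k‖ ≤ √V * ‖f‖ := by
  have h1 : eLpNorm f 1 (volume.restrict E) ≤ ENNReal.ofReal (√V * ‖f‖) := by
    refine (eLpNorm_le_eLpNorm_mul_rpow_measure_univ (q := 2) (by norm_num)
      (Lp.aestronglyMeasurable f).restrict).trans ?_
    rw [Measure.restrict_apply_univ, mul_comm, ENNReal.ofReal_mul (Real.sqrt_nonneg _)]
    refine mul_le_mul' ?_ ?_
    · have : (1 / (1 : ℝ≥0∞).toReal - 1 / (2 : ℝ≥0∞).toReal : ℝ) = 1 / 2 := by norm_num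
      rw [this, Real.sqrt_eq_rpow, ← ENNReal.ofReal_rpow_of_nonneg hV0 (by norm_num)]
      exact ENNReal.rpow_le_rpow hV (by norm_num)
    · refine (eLpNorm_restrict_le _ _ _ _).trans ?_
      rw [Lp.norm_def, ENNReal.ofReal_toReal (Lp.eLpNorm_ne_top f)]
  have h2 : ∫ k, ‖cut E f k‖ = ∫ k in E, ‖f k‖ := by
    rw [← integral_indicator hE]
    refine integral_congr_ae ?_
    filter_upwards [coeFn_cut hE f] with k hk
    rw [hk, norm_indicator_eq_indicator_norm]
  rw [h2, integral_norm_eq_lintegral_enorm (Lp.aestronglyMeasurable f).restrict,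
    ← eLpNorm_one_eq_lintegral_enorm]
  exact ENNReal.toReal_le_of_le_ofReal (by positivity) h1

theorem norm_fourierInv_le (f : Plane → ℂ) (z : Plane) : ‖𝓕⁻ f z‖ ≤ ∫ k, ‖f k‖ :=
  VectorFourier.norm_fourierIntegral_le_integral_norm _ _ _ _ _

theorem cut_eq_self {E : Set Plane} (hE : MeasurableSet E) {f : L2}
    (hf : ∀ᵐ k, k ∉ E → f k = 0) : cut E f = f := by
  refine Lp.ext ?_
  filter_upwards [coeFn_cut hE f, hf] with k h1 h2
  rw [h1]
  by_cases h : k ∈ E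
  · simp [h]
  · simp [h, h2 h]

/-- Bernstein's inequality: the sup norm is at most the `L¹` norm on the frequency side, which
Cauchy–Schwarz controls on a set of measure at most `V`. -/
theorem norm_fourierInv_le_of_support {E : Set Plane} (hE : MeasurableSet E) {V : ℝ} (hV0 : 0 ≤ V)
    (hV : volume E ≤ ENNReal.ofReal V) {f : L2} (hf : ∀ᵐ k, k ∉ E → f k = 0) :
    ∀ᵐ z, ‖(𝓕⁻ f : L2) z‖ ≤ √V * ‖f‖ := by
  have hfin : volume E ≠ ∞ := (hV.trans_lt ENNReal.ofReal_lt_top).ne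
  have hi := integrable_cut hE hfin f
  have hb := integral_norm_cut_le hE hV0 hV f
  rw [cut_eq_self hE hf] at hi hb
  filter_upwards [coeFn_fourierInv_of_integrable f hi] with z hz
  rw [hz]
  exact (norm_fourierInv_le _ z).trans hb

/-- Interpolation between `L²` and `L^∞`. -/
theorem eLpNorm_le_of_bound {q A B : ℝ} (hq : 2 < q) (hA : 0 ≤ A) (hB : 0 ≤ B) {u : L2}
    (hu : ∀ᵐ z, ‖u z‖ ≤ A) (hu2 : ‖u‖ ≤ B) :
    eLpNorm u (ENNReal.ofReal q) volume ≤ ENNReal.ofReal (A ^ (1 - 2 / q) * B ^ (2 / q)) := by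
  have hq0 : 0 < q := by linarith
  have h2 : ∫⁻ z, ‖u z‖ₑ ^ (2 : ℝ) ≤ ENNReal.ofReal (B ^ (2 : ℝ)) := by
    have h3 : eLpNorm u 2 volume ≤ ENNReal.ofReal B := by
      rw [← ENNReal.ofReal_toReal (Lp.eLpNorm_ne_top u), ← Lp.norm_def]
      exact ENNReal.ofReal_le_ofReal hu2
    rw [eLpNorm_eq_lintegral_rpow_enorm_toReal (by norm_num) (by norm_num)] at h3
    have h4 := ENNReal.rpow_le_rpow h3 (z := 2) (by norm_num)
    rw [← ENNReal.rpow_mul, ENNReal.ofReal_rpow_of_nonneg hB (by norm_num)] at h4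
    simpa using h4
  rw [eLpNorm_eq_lintegral_rpow_enorm_toReal (by simpa using hq0) ENNReal.ofReal_ne_top,
    ENNReal.toReal_ofReal hq0.le]
  have h5 : ∫⁻ z, ‖u z‖ₑ ^ q ≤ ENNReal.ofReal (A ^ (q - 2) * B ^ (2 : ℝ)) := by
    calc ∫⁻ z, ‖u z‖ₑ ^ q ≤ ∫⁻ z, ENNReal.ofReal (A ^ (q - 2)) * ‖u z‖ₑ ^ (2 : ℝ) := by
          refine lintegral_mono_ae ?_
          filter_upwards [hu] with z hz
          have h6 : ‖u z‖ₑ ≤ ENNReal.ofReal A := by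
            rw [← ofReal_norm]; exact ENNReal.ofReal_le_ofReal hz
          rw [← ENNReal.ofReal_rpow_of_nonneg hA (by linarith)]
          calc ‖u z‖ₑ ^ q = ‖u z‖ₑ ^ (q - 2) * ‖u z‖ₑ ^ (2 : ℝ) := by
                rw [← ENNReal.rpow_add_of_nonneg _ _ (by linarith) (by norm_num)]
                congr 1; ring
            _ ≤ _ := by gcongr
      _ = ENNReal.ofReal (A ^ (q - 2)) * ∫⁻ z, ‖u z‖ₑ ^ (2 : ℝ) :=
          lintegral_const_mul' _ _ ENNReal.ofReal_ne_top
      _ ≤ _ := by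
          rw [ENNReal.ofReal_mul (by positivity)]
          gcongr
  refine (ENNReal.rpow_le_rpow h5 (by positivity)).trans ?_
  rw [ENNReal.ofReal_rpow_of_nonneg (by positivity) (by positivity),
    Real.mul_rpow (by positivity) (by positivity), ← Real.rpow_mul hA, ← Real.rpow_mul hB]
  refine ENNReal.ofReal_le_ofReal (le_of_eq ?_)
  congr 2
  · field_simp
  · ring

/-- Fatou's lemma, through convergence in measure. -/
theorem eLpNorm_le_of_tendsto {q : ℝ≥0∞} {u : ℕ → L2} {u' : L2} {B : ℝ≥0∞}
    (hu : Filter.Tendsto u Filter.atTop (nhds u'))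
    (hB : ∀ᶠ n in Filter.atTop, eLpNorm (u n) q volume ≤ B) : eLpNorm u' q volume ≤ B :=
  eLpNorm_le_of_tendstoInMeasure hB (tendstoInMeasure_of_tendsto_Lp hu)
    fun n => Lp.aestronglyMeasurable (u n)

/-! ### Sublevel sets of the symbol and dyadic blocks -/

namespace Params

variable (P : Params)

/-- The low frequencies. -/
def low (R : ℝ) : Set Plane := {k | P.symb k ≤ R}

/-- The high frequencies. -/
def high (R : ℝ) : Set Plane := {k | R < P.symb k}

theorem measurableSet_low (R : ℝ) : MeasurableSet (P.low R) :=
  measurableSet_le P.measurable_symb measurable_const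

theorem measurableSet_high (R : ℝ) : MeasurableSet (P.high R) :=
  measurableSet_lt measurable_const P.measurable_symb

/-- A constant in the volume bound for sublevel sets of the symbol. -/
def volConst : ℝ := 4 / (1 - |P.v|)

theorem volConst_pos : 0 < P.volConst := div_pos (by norm_num) (by linarith [P.abs_v_lt])

/-- The sublevel set lies in a box with half-sides `√R` and `R / (1 - |v|)`. The resulting power
`R^(3/2)` is that of a ball in dimension three for a second order symbol, whence the critical
exponent `6`. -/
theorem volume_low_le (R : ℝ) :
    volume (P.low R) ≤ ENNReal.ofReal (P.volConst * (√R * R)) := by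
  have hv : 0 < 1 - |P.v| := by linarith [P.abs_v_lt]
  set b : Fin 2 → ℝ := ![√R, R / (1 - |P.v|)] with hb
  have hsub : P.low R ⊆ (@WithLp.ofLp 2 (Fin 2 → ℝ)) ⁻¹' Set.Icc (-b) b := by
    intro k hk
    have hk' : P.symb k ≤ R := hk
    have h1 := P.symb_ge k
    have hpi : 1 ≤ 2 * Real.pi := by linarith [Real.pi_gt_three]
    have h2 : 0 ≤ (1 - |P.v|) * (2 * Real.pi * |k 1|) := by positivity
    have h3 : |k 0| ≤ √R := by
      refine Real.le_sqrt_of_sq_le ?_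
      rw [sq_abs]
      have h4 : k 0 ^ 2 ≤ (2 * Real.pi * k 0) ^ 2 := by
        rw [mul_pow]
        exact le_mul_of_one_le_left (sq_nonneg _) (one_le_pow₀ hpi)
      linarith [P.ω_pos]
    have h5 : |k 1| ≤ R / (1 - |P.v|) := by
      rw [le_div_iff₀ hv]
      have h6 : |k 1| ≤ 2 * Real.pi * |k 1| := le_mul_of_one_le_left (abs_nonneg _) hpi
      nlinarith [P.ω_pos, sq_nonneg (2 * Real.pi * k 0)]
    rw [Set.mem_preimage, Set.mem_Icc, Pi.le_def, Pi.le_def]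
    refine ⟨fun i => ?_, fun i => ?_⟩
    · fin_cases i
      · exact (abs_le.1 h3).1
      · exact (abs_le.1 h5).1
    · fin_cases i
      · exact (abs_le.1 h3).2
      · exact (abs_le.1 h5).2
  refine (measure_mono hsub).trans ?_
  rw [(PiLp.volume_preserving_ofLp (Fin 2)).measure_preimage measurableSet_Icc.nullMeasurableSet,
    Real.volume_Icc_pi, Fin.prod_univ_two, ← ENNReal.ofReal_mul (by simp [hb])]
  refine ENNReal.ofReal_le_ofReal (le_of_eq ?_)
  simp only [hb, volConst, Pi.neg_apply, Matrix.cons_val_zero, Matrix.cons_val_one]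
  field_simp
  ring

/-- The exponent of decay of dyadic blocks. -/
def decay (q : ℝ) : ℝ := 1 / 2 - 3 / 4 * (1 - 2 / q)

theorem decay_pos {q : ℝ} (hq : 2 < q) (hq6 : q < 6) : 0 < decay q := by
  unfold decay
  have : 1 / 3 < 2 / q := by rw [div_lt_div_iff₀ (by norm_num) (by linarith)]; linarith
  linarith

/-- The constant in the bound for dyadic blocks. -/
def blockConst (q : ℝ) : ℝ := (√(3 * P.volConst)) ^ (1 - 2 / q)

theorem blockConst_pos (q : ℝ) : 0 < P.blockConst q :=
  Real.rpow_pos_of_pos (Real.sqrt_pos.2 (mul_pos (by norm_num) P.volConst_pos)) _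

theorem norm_mulOp_invSqrt_le {g : L2} {r : ℝ} (hr : 0 < r)
    (h : ∀ᵐ k, g k ≠ 0 → r ≤ P.symb k) : ‖mulOp P.invSqrt g‖ ≤ (√r)⁻¹ * ‖g‖ := by
  have := P.norm_T_le_of_symb_ge hr h
  rwa [T_apply, norm_fourierInv] at this

theorem mulOp_eq_zero_off {m : BddSymbol} {g : L2} {E : Set Plane}
    (hg : ∀ᵐ k, k ∉ E → g k = 0) : ∀ᵐ k, k ∉ E → mulOp m g k = 0 := by
  filter_upwards [coeFn_mulOp m g, hg] with k h1 h2 hk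
  rw [h1, h2 hk, mul_zero]

theorem norm_T_apply_le {g : L2} {r R : ℝ} (hr : 0 < r) (hR : 0 ≤ R)
    (hg : ∀ᵐ k, g k ≠ 0 → r ≤ P.symb k) (hg' : ∀ᵐ k, k ∉ P.low R → g k = 0) :
    ∀ᵐ z, ‖P.T g z‖ ≤ √(P.volConst * (√R * R)) * ((√r)⁻¹ * ‖g‖) := by
  have h := norm_fourierInv_le_of_support (P.measurableSet_low R)
    (mul_nonneg P.volConst_pos.le (by positivity)) (P.volume_low_le R)
    (mulOp_eq_zero_off (m := P.invSqrt) hg')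
  filter_upwards [h] with z hz
  rw [T_apply]
  refine hz.trans ?_
  gcongr
  exact P.norm_mulOp_invSqrt_le hr hg

/-- Bernstein bounds the sup norm by a multiple of `ρ^(3/4) * ρ^(-1/2) * ‖g‖`, Plancherel the `L²`
norm by `ρ^(-1/2) * ‖g‖`. Interpolating with weights `1 - 2/q` and `2/q` produces the exponent
`-decay q`. -/
theorem eLpNorm_T_block_le {q : ℝ} (hq : 2 < q) {g : L2} {ρ : ℝ} (hρ : 0 < ρ)
    (hg : ∀ᵐ k, g k ≠ 0 → ρ ≤ P.symb k) (hg' : ∀ᵐ k, k ∉ P.low (2 * ρ) → g k = 0) :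
    eLpNorm (P.T g) (ENNReal.ofReal q) volume
      ≤ ENNReal.ofReal (P.blockConst q * ρ ^ (-decay q) * ‖g‖) := by
  have hq0 : 0 < q := by linarith
  have hθ : 0 ≤ 1 - 2 / q := by
    rw [sub_nonneg, div_le_one hq0]; exact hq.le
  have hv := P.volConst_pos
  have hA : ∀ᵐ z, ‖P.T g z‖ ≤ √(3 * P.volConst) * ρ ^ (3 / 4 : ℝ) * ((√ρ)⁻¹ * ‖g‖) := by
    filter_upwards [P.norm_T_apply_le hρ (by positivity : 0 ≤ 2 * ρ) hg hg'] with z hz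
    refine hz.trans ?_
    gcongr
    have h1 : ρ ^ (3 / 4 : ℝ) = √(√ρ * ρ) := by
      rw [Real.sqrt_eq_rpow, Real.sqrt_eq_rpow, Real.mul_rpow (by positivity) hρ.le,
        ← Real.rpow_mul hρ.le, ← Real.rpow_add hρ]
      norm_num
    rw [h1, ← Real.sqrt_mul (by positivity)]
    refine Real.sqrt_le_sqrt ?_
    -- The shell reaches up to `2 * ρ`, and `√2 * 2 ≤ 3` is the source of the `3` in `blockConst`.
    have h2 : √2 ≤ 3 / 2 := by
      rw [Real.sqrt_le_left (by norm_num)]; norm_num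
    rw [Real.sqrt_mul (by norm_num)]
    calc P.volConst * (√2 * √ρ * (2 * ρ)) = √2 * (P.volConst * (√ρ * ρ) * 2) := by ring
      _ ≤ 3 / 2 * (P.volConst * (√ρ * ρ) * 2) := by gcongr
      _ = _ := by ring
  refine (eLpNorm_le_of_bound hq (by positivity) (by positivity) hA
    (P.norm_T_le_of_symb_ge hρ hg)).trans (ENNReal.ofReal_le_ofReal (le_of_eq ?_))
  have hN : ((√ρ)⁻¹ * ‖g‖) ^ (1 - 2 / q) * ((√ρ)⁻¹ * ‖g‖) ^ (2 / q) = (√ρ)⁻¹ * ‖g‖ := by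
    rw [← Real.rpow_add_of_nonneg (by positivity) hθ (by positivity), sub_add_cancel,
      Real.rpow_one]
  rw [Real.mul_rpow (by positivity) (by positivity), mul_assoc, hN,
    Real.mul_rpow (by positivity) (by positivity), ← Real.rpow_mul hρ.le, blockConst, decay,
    Real.sqrt_eq_rpow ρ, ← Real.rpow_neg hρ.le]
  have : ρ ^ (-(1 / 2 - 3 / 4 * (1 - 2 / q))) = ρ ^ (3 / 4 * (1 - 2 / q)) * ρ ^ (-(1 / 2 : ℝ)) := by
    rw [← Real.rpow_add hρ]; congr 1; ring
  rw [this]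
  ring

end Params

theorem cut_apply_eq_zero {E : Set Plane} (hE : MeasurableSet E) (g : L2) :
    ∀ᵐ k, k ∉ E → cut E g k = 0 := by
  filter_upwards [coeFn_cut hE g] with k hk h
  rw [hk, Set.indicator_of_notMem h]

theorem mem_of_cut_ne_zero {E : Set Plane} (hE : MeasurableSet E) (g : L2) :
    ∀ᵐ k, cut E g k ≠ 0 → k ∈ E := by
  filter_upwards [cut_apply_eq_zero hE g] with k hk h
  by_contra h'
  exact h (hk h')

theorem norm_cut_le {E : Set Plane} (hE : MeasurableSet E) (g : L2) : ‖cut E g‖ ≤ ‖g‖ := by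
  refine (Lp.norm_le_mul_norm_of_ae_le_mul (c := 1) ?_).trans_eq (one_mul _)
  filter_upwards [coeFn_cut hE g] with k hk
  rw [hk, one_mul]
  exact norm_indicator_le_norm_self _ _

/-! ### Characters -/

/-- The character `k ↦ exp (2 π i ⟪k, z⟫)`. -/
def modSymbol (z : Plane) : BddSymbol where
  toFun k := Complex.exp ((2 * Real.pi * inner ℝ k z : ℝ) * Complex.I)
  measurable' := by fun_prop
  bound' := ⟨1, fun k => (Complex.norm_exp_ofReal_mul_I _).le⟩

theorem modSymbol_apply (z k : Plane) :
    modSymbol z k = Complex.exp ((2 * Real.pi * inner ℝ k z : ℝ) * Complex.I) := rfl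

theorem norm_modSymbol (z k : Plane) : ‖modSymbol z k‖ = 1 :=
  Complex.norm_exp_ofReal_mul_I _

theorem modSymbol_add (z w k : Plane) :
    modSymbol (z + w) k = modSymbol z k * modSymbol w k := by
  rw [modSymbol_apply, modSymbol_apply, modSymbol_apply, ← Complex.exp_add, inner_add_right]
  congr 1
  push_cast
  ring

theorem fourierInv_eq_integral_modSymbol (f : Plane → ℂ) (z : Plane) :
    𝓕⁻ f z = ∫ k, modSymbol z k * f k := by
  rw [Real.fourierInv_eq']
  rfl

theorem norm_mulOp_modSymbol (z : Plane) (g : L2) : ‖mulOp (modSymbol z) g‖ = ‖g‖ := by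
  rw [Lp.norm_def, Lp.norm_def]
  congr 1
  refine eLpNorm_congr_norm_ae ?_
  filter_upwards [coeFn_mulOp (modSymbol z) g] with k hk
  rw [hk, norm_mul, norm_modSymbol, one_mul]

/-! ### The Sobolev embedding by summation over dyadic shells -/

namespace Params

variable (P : Params)

theorem low_union_high (R : ℝ) : P.low R ∪ P.high R = Set.univ := by
  ext k
  simp [low, high, le_or_gt]

theorem disjoint_low_high (R : ℝ) : Disjoint (P.low R) (P.high R) :=
  Set.disjoint_left.2 fun k h h' =>
    not_lt_of_ge (show P.symb k ≤ R from h) (show R < P.symb k from h')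

theorem cut_low_add_cut_high (R : ℝ) (g : L2) : cut (P.low R) g + cut (P.high R) g = g := by
  rw [cut_add_cut (P.measurableSet_low R) (P.measurableSet_high R) (P.disjoint_low_high R),
    low_union_high, cut_univ]

theorem norm_T_cut_high_le {R : ℝ} (hR : 0 < R) (g : L2) :
    ‖P.T (cut (P.high R) g)‖ ≤ (√R)⁻¹ * ‖g‖ := by
  refine (P.norm_T_le_of_symb_ge hR ?_).trans
    (mul_le_mul_of_nonneg_left (norm_cut_le (P.measurableSet_high R) g) (by positivity))
  filter_upwards [mem_of_cut_ne_zero (P.measurableSet_high R) g] with k hk h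
  exact (hk h).le

theorem tendsto_inv_sqrt_two_pow (a : ℝ) :
    Filter.Tendsto (fun n : ℕ => (√((2 : ℝ) ^ n))⁻¹ * a) Filter.atTop (nhds 0) := by
  have h1 : Filter.Tendsto (fun n : ℕ => √((2 : ℝ) ^ n)) Filter.atTop Filter.atTop :=
    Real.tendsto_sqrt_atTop.comp (tendsto_pow_atTop_atTop_of_one_lt (by norm_num))
  simpa using h1.inv_tendsto_atTop.mul_const a

theorem tendsto_T_cut_low (g : L2) :
    Filter.Tendsto (fun n : ℕ => P.T (cut (P.low (2 ^ n)) g)) Filter.atTop (nhds (P.T g)) := by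
  rw [tendsto_iff_norm_sub_tendsto_zero]
  refine squeeze_zero (fun n => norm_nonneg _) (fun n => ?_) (tendsto_inv_sqrt_two_pow ‖g‖)
  have : P.T (cut (P.low (2 ^ n)) g) - P.T g = -P.T (cut (P.high (2 ^ n)) g) := by
    conv_lhs => rw [← P.cut_low_add_cut_high (2 ^ n) g]
    rw [map_add, map_add, map_add, ← map_add, ← map_add, ← map_add, P.cut_low_add_cut_high]
    nth_rw 2 [← P.cut_low_add_cut_high (2 ^ n) g]
    rw [map_add]
    abel
  rw [this, norm_neg]
  exact P.norm_T_cut_high_le (by positivity) g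

theorem eLpNorm_T_add_le {q : ℝ} (hq : 1 ≤ q) {f g : L2} {a b : ℝ} (ha : 0 ≤ a) (hb : 0 ≤ b)
    (hf : eLpNorm (P.T f) (ENNReal.ofReal q) volume ≤ ENNReal.ofReal a)
    (hg : eLpNorm (P.T g) (ENNReal.ofReal q) volume ≤ ENNReal.ofReal b) :
    eLpNorm (P.T (f + g)) (ENNReal.ofReal q) volume ≤ ENNReal.ofReal (a + b) := by
  rw [map_add, eLpNorm_congr_ae (Lp.coeFn_add _ _), ENNReal.ofReal_add ha hb]
  exact (eLpNorm_add_le (Lp.aestronglyMeasurable _) (Lp.aestronglyMeasurable _)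
    (ENNReal.one_le_ofReal.2 hq)).trans (add_le_add hf hg)

/-- The ratio of the geometric series of dyadic blocks. -/
def ratio (q : ℝ) : ℝ := 2 ^ (-decay q)

theorem ratio_pos (q : ℝ) : 0 < ratio q := by unfold ratio; positivity

theorem ratio_lt_one {q : ℝ} (hq : 2 < q) (hq6 : q < 6) : ratio q < 1 :=
  Real.rpow_lt_one_of_one_lt_of_neg (by norm_num) (neg_lt_zero.2 (decay_pos hq hq6))

theorem two_pow_rpow_neg_decay (q : ℝ) (n : ℕ) : ((2 : ℝ) ^ n) ^ (-decay q) = ratio q ^ n := by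
  rw [ratio, ← Real.rpow_natCast, ← Real.rpow_natCast, ← Real.rpow_mul (by norm_num),
    ← Real.rpow_mul (by norm_num), mul_comm]

theorem eLpNorm_T_cut_dyadic_le {q : ℝ} (hq : 2 < q) (J n : ℕ) (g : L2) :
    eLpNorm (P.T (cut (P.high (2 ^ J) ∩ P.low (2 ^ (J + n))) g)) (ENNReal.ofReal q) volume
      ≤ ENNReal.ofReal (∑ i ∈ Finset.range n, P.blockConst q * ratio q ^ (J + i) * ‖g‖) := by
  have hm : ∀ a b, MeasurableSet (P.high a ∩ P.low b) := fun a b =>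
    (P.measurableSet_high a).inter (P.measurableSet_low b)
  have hC := P.blockConst_pos q
  have hr := ratio_pos q
  induction n with
  | zero =>
    have h : P.high (2 ^ J) ∩ P.low (2 ^ (J + 0)) = ∅ := by
      ext k
      simp only [high, low, Set.mem_inter_iff, Set.mem_ofPred_eq, add_zero,
        Set.mem_empty_iff_false, iff_false, not_and, not_le, imp_self]
    have h0 : cut (∅ : Set Plane) g = 0 := by
      refine Lp.ext ?_
      filter_upwards [coeFn_cut MeasurableSet.empty g, Lp.coeFn_zero ℂ 2 volume] with k h1 h2
      rw [h1, h2]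
      simp
    rw [h, h0, map_zero, eLpNorm_congr_ae (Lp.coeFn_zero ℂ 2 volume)]
    simp
  | succ n ih =>
    have h2 : (2 : ℝ) ^ J ≤ 2 ^ (J + n) := pow_le_pow_right₀ (by norm_num) (by omega)
    have h3 : (2 : ℝ) ^ (J + (n + 1)) = 2 * 2 ^ (J + n) := by ring
    -- The induction peels off the top shell, to which the block estimate applies with `ρ = 2 ^ (J +
    -- n)`.
    have hu : P.high (2 ^ J) ∩ P.low (2 ^ (J + (n + 1))) = (P.high (2 ^ J) ∩ P.low (2 ^ (J + n))) ∪
        (P.high (2 ^ (J + n)) ∩ P.low (2 ^ (J + (n + 1)))) := by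
      ext k
      simp only [high, low, Set.mem_inter_iff, Set.mem_union, Set.mem_ofPred_eq]
      have h4 : (0 : ℝ) < 2 ^ (J + n) := by positivity
      constructor
      · rintro ⟨ha, hb⟩
        rcases le_or_gt (P.symb k) (2 ^ (J + n)) with h | h
        · exact Or.inl ⟨ha, h⟩
        · exact Or.inr ⟨h, hb⟩
      · rintro (⟨ha, hb⟩ | ⟨ha, hb⟩)
        · exact ⟨ha, by linarith⟩
        · exact ⟨by linarith, hb⟩
    have hd : Disjoint (P.high (2 ^ J) ∩ P.low (2 ^ (J + n)))
        (P.high (2 ^ (J + n)) ∩ P.low (2 ^ (J + (n + 1)))) :=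
      Set.disjoint_left.2 fun k hk hk' =>
        Set.disjoint_left.1 (P.disjoint_low_high _) hk.2 hk'.1
    rw [hu, ← cut_add_cut (hm _ _) (hm _ _) hd, Finset.sum_range_succ]
    refine P.eLpNorm_T_add_le (by linarith) (by positivity) (by positivity) ih ?_
    refine (P.eLpNorm_T_block_le hq (ρ := 2 ^ (J + n)) (by positivity) ?_ ?_).trans
      (ENNReal.ofReal_le_ofReal ?_)
    · filter_upwards [mem_of_cut_ne_zero (hm _ _) g] with k hk h
      exact (hk h).1.le
    · filter_upwards [cut_apply_eq_zero (hm (2 ^ (J + n)) (2 ^ (J + (n + 1)))) g] with k hk h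
      refine hk fun h' => h ?_
      rw [← h3]
      exact h'.2
    · rw [two_pow_rpow_neg_decay]
      gcongr
      exact norm_cut_le (hm _ _) g

/-- The constant in the high frequency embedding. -/
def tailConst (q : ℝ) : ℝ := P.blockConst q * (1 - ratio q)⁻¹

theorem sum_dyadic_le {q : ℝ} (hq : 2 < q) (hq6 : q < 6) (J n : ℕ) {a : ℝ} (ha : 0 ≤ a) :
    ∑ i ∈ Finset.range n, P.blockConst q * ratio q ^ (J + i) * a
      ≤ P.tailConst q * ratio q ^ J * a := by
  have h : ∑ i ∈ Finset.range n, P.blockConst q * ratio q ^ (J + i) * a =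
      P.blockConst q * ratio q ^ J * a * ∑ i ∈ Finset.range n, ratio q ^ i := by
    rw [Finset.mul_sum]
    refine Finset.sum_congr rfl fun i _ => ?_
    ring
  have hC := P.blockConst_pos q
  have hr := ratio_pos q
  rw [h, tailConst]
  have hg : ∑ i ∈ Finset.range n, ratio q ^ i ≤ (1 - ratio q)⁻¹ := by
    have := (summable_geometric_of_lt_one hr.le (ratio_lt_one hq hq6)).sum_le_tsum
      (Finset.range n) (fun i _ => by positivity)
    rwa [tsum_geometric_of_lt_one hr.le (ratio_lt_one hq hq6)] at this
  calc _ ≤ P.blockConst q * ratio q ^ J * a * (1 - ratio q)⁻¹ := by gcongr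
    _ = _ := by ring

/-- The dyadic sums are bounded uniformly in the number of shells, and the bound passes to the `L²`
limit. The factor `ratio q ^ J` makes the tail uniformly small on bounded sets, which drives the
compactness argument. -/
theorem eLpNorm_T_cut_high_le {q : ℝ} (hq : 2 < q) (hq6 : q < 6) (J : ℕ) (g : L2) :
    eLpNorm (P.T (cut (P.high (2 ^ J)) g)) (ENNReal.ofReal q) volume
      ≤ ENNReal.ofReal (P.tailConst q * ratio q ^ J * ‖g‖) := by
  refine eLpNorm_le_of_tendsto (P.tendsto_T_cut_low (cut (P.high (2 ^ J)) g)) ?_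
  filter_upwards [Filter.eventually_ge_atTop J] with n hn
  obtain ⟨m, rfl⟩ := Nat.exists_eq_add_of_le hn
  have h : cut (P.low (2 ^ (J + m))) (cut (P.high (2 ^ J)) g)
      = cut (P.high (2 ^ J) ∩ P.low (2 ^ (J + m))) g := by
    refine Lp.ext ?_
    filter_upwards [coeFn_cut (P.measurableSet_low (2 ^ (J + m))) (cut (P.high (2 ^ J)) g),
      coeFn_cut (P.measurableSet_high (2 ^ J)) g,
      coeFn_cut ((P.measurableSet_high (2 ^ J)).inter (P.measurableSet_low (2 ^ (J + m)))) g]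
      with k h1 h2 h3
    rw [h1, h3, Set.inter_comm, ← Set.indicator_indicator]
    by_cases hk : k ∈ P.low (2 ^ (J + m))
    · simp only [Set.indicator_of_mem hk, h2]
    · simp only [Set.indicator_of_notMem hk]
  rw [h]
  exact (P.eLpNorm_T_cut_dyadic_le hq J m g).trans
    (ENNReal.ofReal_le_ofReal (P.sum_dyadic_le hq hq6 J m (norm_nonneg _)))

theorem norm_T_cut_low_apply_le {R : ℝ} (hR : 0 ≤ R) (g : L2) :
    ∀ᵐ z, ‖P.T (cut (P.low R) g) z‖ ≤ √(P.volConst * (√R * R)) * ((√P.ω)⁻¹ * ‖g‖) := by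
  filter_upwards [P.norm_T_apply_le P.ω_pos hR
    (Filter.Eventually.of_forall fun k _ => P.ω_le_symb k)
    (cut_apply_eq_zero (P.measurableSet_low R) g)] with z hz
  refine hz.trans ?_
  gcongr
  exact norm_cut_le (P.measurableSet_low R) g

theorem norm_T_cut_low_le (R : ℝ) (g : L2) :
    ‖P.T (cut (P.low R) g)‖ ≤ (√P.ω)⁻¹ * ‖g‖ := by
  refine (P.norm_T_le _).trans ?_
  gcongr
  exact norm_cut_le (P.measurableSet_low R) g

/-- The Sobolev embedding of the energy space. -/
theorem exists_eLpNorm_T_le {q : ℝ} (hq : 2 < q) (hq6 : q < 6) :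
    ∃ C, 0 ≤ C ∧ ∀ g, eLpNorm (P.T g) (ENNReal.ofReal q) volume ≤ ENNReal.ofReal (C * ‖g‖) := by
  have hq0 : 0 < q := by linarith
  have hθ : 0 ≤ 1 - 2 / q := by
    rw [sub_nonneg, div_le_one hq0]; exact hq.le
  have hC := P.blockConst_pos q
  have hr := ratio_pos q
  have hr1 : 0 < 1 - ratio q := by linarith [ratio_lt_one hq hq6]
  have hv := P.volConst_pos
  -- The splitting is at level `2 ^ 0 = 1`: below it, interpolation with the lower bound `ω` on the
  -- symbol; above it, the tail estimate.
  refine ⟨(√(P.volConst * (√1 * 1))) ^ (1 - 2 / q) * (√P.ω)⁻¹ + P.tailConst q * ratio q ^ 0,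
    by unfold tailConst; positivity, fun g => ?_⟩
  rw [add_mul]
  conv_lhs => rw [← P.cut_low_add_cut_high (2 ^ 0) g]
  refine P.eLpNorm_T_add_le (by linarith) (by positivity) (by unfold tailConst; positivity) ?_
    (P.eLpNorm_T_cut_high_le hq hq6 0 g)
  have h1 := P.norm_T_cut_low_apply_le (R := 2 ^ 0) (by norm_num) g
  have h2 := P.norm_T_cut_low_le (2 ^ 0) g
  refine (eLpNorm_le_of_bound hq (by positivity) (by positivity) h1 h2).trans
    (ENNReal.ofReal_le_ofReal (le_of_eq ?_))
  rw [Real.mul_rpow (by positivity) (by positivity), mul_assoc,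
    ← Real.rpow_add_of_nonneg (by positivity) hθ (by positivity), sub_add_cancel, Real.rpow_one,
    pow_zero, mul_assoc]

/-! ### Point values of low frequency parts, and translations -/

/-- The value at `z` of the low frequency part of `T g`. -/
def ev (R : ℝ) (z : Plane) (g : L2) : ℂ :=
  𝓕⁻ (mulOp P.invSqrt (cut (P.low R) g) : Plane → ℂ) z

theorem volume_low_ne_top (R : ℝ) : volume (P.low R) ≠ ∞ :=
  ((P.volume_low_le R).trans_lt ENNReal.ofReal_lt_top).ne

theorem mulOp_comm (m n : BddSymbol) (g : L2) : mulOp m (mulOp n g) = mulOp n (mulOp m g) := by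
  refine Lp.ext ?_
  filter_upwards [coeFn_mulOp m (mulOp n g), coeFn_mulOp n g, coeFn_mulOp n (mulOp m g),
    coeFn_mulOp m g] with k h1 h2 h3 h4
  rw [h1, h2, h3, h4]
  ring

theorem integrable_mulOp_cut_low (R : ℝ) (g : L2) :
    Integrable (mulOp P.invSqrt (cut (P.low R) g)) := by
  rw [cut, mulOp_comm]
  exact integrable_cut (P.measurableSet_low R) (P.volume_low_ne_top R) _

theorem T_cut_low_ae_eq (R : ℝ) (g : L2) :
    P.T (cut (P.low R) g) =ᵐ[volume] fun z => P.ev R z g := by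
  rw [T_apply]
  exact coeFn_fourierInv_of_integrable _ (P.integrable_mulOp_cut_low R g)

theorem continuous_ev (R : ℝ) (g : L2) : Continuous fun z => P.ev R z g :=
  continuous_fourierInv (P.integrable_mulOp_cut_low R g)

theorem ev_mulOp_modSymbol (R : ℝ) (z w : Plane) (g : L2) :
    P.ev R w (mulOp (modSymbol z) g) = P.ev R (w + z) g := by
  rw [ev, ev, fourierInv_eq_integral_modSymbol, fourierInv_eq_integral_modSymbol, cut,
    mulOp_comm (cutSymbol _), mulOp_comm P.invSqrt]
  refine integral_congr_ae ?_
  filter_upwards [coeFn_mulOp (modSymbol z) (mulOp P.invSqrt (mulOp (cutSymbol (P.low R)) g))]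
    with k hk
  rw [hk, modSymbol_add]
  ring

/-- `ev R z` is represented by an element of `L²`. -/
theorem exists_ev_eq_inner (R : ℝ) (z : Plane) : ∃ K : L2, ∀ g, P.ev R z g = inner ℂ K g := by
  -- The sign in `-z` compensates the conjugation in the first slot of the inner product.
  refine ⟨mulOp (modSymbol (-z)) (mulOp P.invSqrt
    (indicatorConstLp 2 (P.measurableSet_low R) (P.volume_low_ne_top R) (1 : ℂ))), fun g => ?_⟩
  rw [ev, fourierInv_eq_integral_modSymbol, inner_L2]
  refine integral_congr_ae ?_
  filter_upwards [coeFn_mulOp (modSymbol (-z)) (mulOp P.invSqrt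
    (indicatorConstLp 2 (P.measurableSet_low R) (P.volume_low_ne_top R) (1 : ℂ))),
    coeFn_mulOp P.invSqrt
      (indicatorConstLp 2 (P.measurableSet_low R) (P.volume_low_ne_top R) (1 : ℂ)),
    indicatorConstLp_coeFn (p := 2) (hs := P.measurableSet_low R)
      (hμs := P.volume_low_ne_top R) (c := (1 : ℂ)),
    coeFn_mulOp P.invSqrt (cut (P.low R) g), coeFn_cut (P.measurableSet_low R) g]
    with k h1 h2 h3 h4 h5
  rw [h1, h2, h3, h4, h5, map_mul, map_mul, invSqrt_apply, Complex.conj_ofReal,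
    modSymbol_apply, modSymbol_apply, ← Complex.exp_conj]
  have : conj (((2 * Real.pi * inner ℝ k (-z) : ℝ) : ℂ) * Complex.I)
      = ((2 * Real.pi * inner ℝ k z : ℝ) : ℂ) * Complex.I := by
    rw [map_mul, Complex.conj_ofReal, Complex.conj_I, inner_neg_right]
    push_cast
    ring
  rw [this]
  by_cases hk : k ∈ P.low R
  · simp [hk]
    ring
  · simp [hk]

/-- Modulation on the Fourier side is translation. -/
theorem T_mulOp_modSymbol (z : Plane) (g : L2) :
    P.T (mulOp (modSymbol z) g) = Lp.compMeasurePreserving (fun x => x + z)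
      (measurePreserving_add_right volume z) (P.T g) := by
  -- Low frequency truncations have a pointwise formula that shows the translation. Both sides are
  -- `L²` limits of these truncations.
  refine tendsto_nhds_unique (P.tendsto_T_cut_low (mulOp (modSymbol z) g)) ?_
  have hc := ((Lp.isometry_compMeasurePreserving (E := ℂ) (p := 2)
    (measurePreserving_add_right (volume : Measure Plane) z)).continuous.tendsto (P.T g)).comp
    (P.tendsto_T_cut_low g)
  refine hc.congr fun n => Lp.ext ?_
  have h1 := Lp.coeFn_compMeasurePreserving (P.T (cut (P.low (2 ^ n)) g))
    (measurePreserving_add_right (volume : Measure Plane) z)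
  have h2 := (measurePreserving_add_right (volume : Measure Plane) z).quasiMeasurePreserving.ae_eq_comp
    (P.T_cut_low_ae_eq (2 ^ n) g)
  filter_upwards [h1, h2, P.T_cut_low_ae_eq (2 ^ n) (mulOp (modSymbol z) g)] with w h1 h2 h3
  rw [h3, ev_mulOp_modSymbol]
  exact h1.trans h2

/-- A function with nontrivial `L^q` norm has a large low frequency part at some point. -/
theorem exists_le_norm_ev {q : ℝ} (hq : 2 < q) (hq6 : q < 6) {ε : ℝ} (hε : 0 < ε) :
    ∃ R c, 0 < c ∧ ∀ g : L2, ‖g‖ ≤ 1 →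
      ENNReal.ofReal ε ≤ eLpNorm (P.T g) (ENNReal.ofReal q) volume → ∃ z, c ≤ ‖P.ev R z g‖ := by
  have hq0 : 0 < q := by linarith
  have hθ : 0 < 1 - 2 / q := by
    rw [sub_pos, div_lt_one hq0]; exact hq
  have hr := ratio_pos q
  have hr1 := ratio_lt_one hq hq6
  have hC : 0 < P.tailConst q := by
    have := P.blockConst_pos q
    have : 0 < 1 - ratio q := by linarith
    unfold tailConst; positivity
  -- The level is chosen so that the tail contributes less than `ε / 2`. Next, `c` is chosen so that
  -- a low frequency part bounded by `c` everywhere also contributes less than `ε / 2`, by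
  -- interpolation.
  obtain ⟨J, hJ⟩ : ∃ J : ℕ, P.tailConst q * ratio q ^ J < ε / 2 := by
    have := (tendsto_pow_atTop_nhds_zero_of_lt_one hr.le hr1).const_mul (P.tailConst q)
    rw [mul_zero] at this
    exact (this.eventually (gt_mem_nhds (half_pos hε))).exists
  have hω : 0 ≤ (√P.ω)⁻¹ := by positivity
  obtain ⟨c, hc0, hc⟩ : ∃ c : ℝ, 0 < c ∧ c ^ (1 - 2 / q) * (√P.ω)⁻¹ ^ (2 / q) < ε / 2 := by
    have h1 : Filter.Tendsto (fun c : ℝ => c ^ (1 - 2 / q) * (√P.ω)⁻¹ ^ (2 / q))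
        (nhdsWithin 0 (Set.Ioi 0)) (nhds 0) := by
      have h2 : Continuous fun c : ℝ => c ^ (1 - 2 / q) * (√P.ω)⁻¹ ^ (2 / q) :=
        (Real.continuous_rpow_const hθ.le).mul_const _
      have h3 := (h2.tendsto 0).mono_left (nhdsWithin_le_nhds (s := Set.Ioi 0))
      simpa [Real.zero_rpow hθ.ne'] using h3
    obtain ⟨c, h4, h5⟩ :=
      ((h1.eventually (gt_mem_nhds (half_pos hε))).and self_mem_nhdsWithin).exists
    exact ⟨c, h5, h4⟩
  refine ⟨2 ^ J, c, hc0, fun g hg hgε => ?_⟩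
  by_contra! hno
  have hA : ∀ᵐ z, ‖P.T (cut (P.low (2 ^ J)) g) z‖ ≤ c := by
    filter_upwards [P.T_cut_low_ae_eq (2 ^ J) g] with z hz
    rw [hz]
    exact (hno z).le
  have hB : ‖P.T (cut (P.low (2 ^ J)) g)‖ ≤ (√P.ω)⁻¹ :=
    (P.norm_T_cut_low_le _ g).trans (mul_le_of_le_one_right hω hg)
  have h1 := eLpNorm_le_of_bound hq hc0.le hω hA hB
  have h2 := P.eLpNorm_T_add_le (by linarith) (by positivity) (by positivity) h1
    (P.eLpNorm_T_cut_high_le hq hq6 J g)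
  rw [P.cut_low_add_cut_high] at h2
  have h3 := (ENNReal.ofReal_le_ofReal_iff (by positivity)).1 (hgε.trans h2)
  have h4 : P.tailConst q * ratio q ^ J * ‖g‖ ≤ P.tailConst q * ratio q ^ J :=
    mul_le_of_le_one_right (by positivity) hg
  linarith

end Params

/-! ### Weak compactness and almost everywhere convergence -/

/-- Sequential Banach–Alaoglu, with `L2` identified with its dual by the Riesz theorem. -/
theorem exists_weakly_convergent_subseq {g : ℕ → L2} (hg : ∀ n, ‖g n‖ ≤ 1) :
    ∃ (g' : L2) (φ : ℕ → ℕ), StrictMono φ ∧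
      ∀ f : L2, Filter.Tendsto (fun n => inner ℂ f (g (φ n))) Filter.atTop
        (nhds (inner ℂ f g')) := by
  have : Fact ((2 : ℝ≥0∞) ≠ ∞) := ⟨by norm_num⟩
  obtain ⟨ℓ, -, φ, hφ, hlim⟩ := WeakDual.isSeqCompact_closedBall ℂ L2 0 1
    (x := fun n => StrongDual.toWeakDual (InnerProductSpace.toDual ℂ L2 (g n)))
    (fun n => by
      rw [Set.mem_preimage, mem_closedBall_zero_iff]
      exact ((InnerProductSpace.toDual ℂ L2).norm_map (g n)).trans_le (hg n))
  refine ⟨(InnerProductSpace.toDual ℂ L2).symm (WeakDual.toStrongDual ℓ), φ, hφ, fun f => ?_⟩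
  have h1 := ((WeakDual.eval_continuous (𝕜 := ℂ) f).tendsto ℓ).comp hlim
  have h2 := (Complex.continuous_conj.tendsto _).comp h1
  have h3 : conj (ℓ f) = inner ℂ f ((InnerProductSpace.toDual ℂ L2).symm
      (WeakDual.toStrongDual ℓ)) := by
    rw [← inner_conj_symm, InnerProductSpace.toDual_symm_apply]
    rfl
  rw [← h3]
  refine h2.congr fun n => ?_
  simp only [Function.comp_apply]
  rw [← inner_conj_symm]
  rfl

/-- There is a finite measure below Lebesgue measure with the same null sets. -/
theorem exists_finite_measure_le :
    ∃ ν : Measure Plane, IsFiniteMeasure ν ∧ ν ≤ volume ∧ (volume : Measure Plane) ≪ ν := by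
  obtain ⟨g, hg0, hgm, hg⟩ := exists_pos_lintegral_lt_of_sigmaFinite (volume : Measure Plane)
    (ε := 1) one_ne_zero
  have hm : Measurable fun x => min (g x : ℝ≥0∞) 1 := hgm.coe_nnreal_ennreal.min measurable_const
  refine ⟨volume.withDensity fun x => min (g x : ℝ≥0∞) 1, ?_, ?_, ?_⟩
  · refine isFiniteMeasure_withDensity (ne_top_of_lt ((lintegral_mono fun x => ?_).trans_lt hg))
    exact min_le_left _ _
  · calc _ ≤ (volume : Measure Plane).withDensity 1 :=
          withDensity_mono (Filter.Eventually.of_forall fun x => min_le_right _ _)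
      _ = volume := withDensity_one
  · refine withDensity_absolutelyContinuous' hm.aemeasurable
      (Filter.Eventually.of_forall fun x => ?_)
    have : (0 : ℝ≥0∞) < min (g x : ℝ≥0∞) 1 := lt_min (by exact_mod_cast hg0 x) one_pos
    exact this.ne'

theorem volume_le_norm_le {u : L2} {a ε : ℝ} (hε : 0 < ε) (hu : ‖u‖ ≤ a) :
    volume {z | ε ≤ ‖u z‖} ≤ ENNReal.ofReal ((a / ε) ^ 2) := by
  have ha : 0 ≤ a := (norm_nonneg _).trans hu
  have h := meas_ge_le_mul_pow_eLpNorm_enorm (volume : Measure Plane) (p := 2) (by norm_num)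
    (by norm_num) (Lp.aestronglyMeasurable u) (ε := ENNReal.ofReal ε)
    (by simpa using hε) (by simp)
  have hset : {z | ENNReal.ofReal ε ≤ ‖u z‖ₑ} = {z | ε ≤ ‖u z‖} := by
    ext z
    simp only [Set.mem_ofPred_eq]
    rw [← ofReal_norm, ENNReal.ofReal_le_ofReal_iff (norm_nonneg _)]
  rw [hset] at h
  refine h.trans ?_
  have hu' : eLpNorm u 2 volume ≤ ENNReal.ofReal a := by
    rw [← ENNReal.ofReal_toReal (Lp.eLpNorm_ne_top u), ← Lp.norm_def]
    exact ENNReal.ofReal_le_ofReal hu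
  rw [← ENNReal.ofReal_inv_of_pos hε]
  have h2 : (2 : ℝ≥0∞).toReal = 2 := by norm_num
  rw [h2, ENNReal.ofReal_rpow_of_nonneg (by positivity) (by norm_num)]
  calc _ ≤ ENNReal.ofReal (ε⁻¹ ^ (2 : ℝ)) * ENNReal.ofReal a ^ (2 : ℝ) := by gcongr
    _ = _ := by
      rw [ENNReal.ofReal_rpow_of_nonneg ha (by norm_num), ← ENNReal.ofReal_mul (by positivity)]
      congr 1
      rw [Real.rpow_two, Real.rpow_two]
      field_simp

namespace Params

variable (P : Params)

/-- Local compactness of the embedding of the energy space in `L²`. -/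
theorem exists_subseq_T_tendsto_ae {h : ℕ → L2} {b : ℝ} (hb : ∀ n, ‖h n‖ ≤ b)
    (hw : ∀ f : L2, Filter.Tendsto (fun n => inner ℂ f (h n)) Filter.atTop (nhds 0)) :
    ∃ φ : ℕ → ℕ, StrictMono φ ∧
      ∀ᵐ z, Filter.Tendsto (fun n => P.T (h (φ n)) z) Filter.atTop (nhds 0) := by
  -- Passing from pointwise convergence to convergence in measure requires a finite measure. As `ν`
  -- has the same null sets as `volume`, the final conclusion transfers back.
  obtain ⟨ν, hν, hνle, hac⟩ := exists_finite_measure_le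
  have hνac : ν ≪ volume := Measure.absolutelyContinuous_of_le hνle
  have key : TendstoInMeasure ν (fun n => (P.T (h n) : Plane → ℂ)) Filter.atTop
      (fun _ => (0 : ℂ)) := by
    rw [tendstoInMeasure_iff_norm]
    intro ε hε
    rw [ENNReal.tendsto_nhds_zero]
    intro δ hδ
    -- By Chebyshev, the high frequency part exceeds `ε / 2` only on a set of measure at most `δ /
    -- 2`, uniformly in `n`. The low frequency part tends to zero at every point, since point values
    -- are inner products with a fixed vector.
    obtain ⟨J, hJ⟩ : ∃ J : ℕ,
        ENNReal.ofReal (((√((2 : ℝ) ^ J))⁻¹ * b / (ε / 2)) ^ 2) ≤ δ / 2 := by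
      have h1 := (ENNReal.tendsto_ofReal
        (((tendsto_inv_sqrt_two_pow b).div_const (ε / 2)).pow 2))
      rw [zero_div, zero_pow two_ne_zero, ENNReal.ofReal_zero, ENNReal.tendsto_nhds_zero] at h1
      exact (h1 (δ / 2) (ENNReal.half_pos hδ.ne')).exists
    have hlow : TendstoInMeasure ν (fun n z => P.ev (2 ^ J) z (h n)) Filter.atTop
        (fun _ => (0 : ℂ)) := by
      refine tendstoInMeasure_of_tendsto_ae
        (fun n => (P.continuous_ev _ _).aestronglyMeasurable)
        (Filter.Eventually.of_forall fun z => ?_)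
      obtain ⟨K, hK⟩ := P.exists_ev_eq_inner (2 ^ J) z
      simp only [hK]
      exact hw K
    rw [tendstoInMeasure_iff_norm] at hlow
    have hlow' := ENNReal.tendsto_nhds_zero.1 (hlow (ε / 2) (half_pos hε)) (δ / 2)
      (ENNReal.half_pos hδ.ne')
    filter_upwards [hlow'] with n hn
    have hsub : {z | ε ≤ ‖P.T (h n) z - 0‖} ≤ᵐ[ν]
        ({z | ε / 2 ≤ ‖P.ev (2 ^ J) z (h n) - 0‖} ∪
          {z | ε / 2 ≤ ‖P.T (cut (P.high (2 ^ J)) (h n)) z‖} : Set Plane) := by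
      have e1 : (P.T (h n) : Plane → ℂ) =ᵐ[volume] fun z => P.T (cut (P.low (2 ^ J)) (h n)) z
          + P.T (cut (P.high (2 ^ J)) (h n)) z := by
        conv_lhs => rw [← P.cut_low_add_cut_high (2 ^ J) (h n), map_add]
        exact Lp.coeFn_add _ _
      filter_upwards [hνac.ae_le e1, hνac.ae_le (P.T_cut_low_ae_eq (2 ^ J) (h n))]
        with z h1 h2 h3
      have h3' : ε ≤ ‖P.T (h n) z - 0‖ := h3
      rw [h1, h2, sub_zero] at h3'
      by_contra hcon
      have hcon' : ¬ (ε / 2 ≤ ‖P.ev (2 ^ J) z (h n) - 0‖ ∨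
        ε / 2 ≤ ‖P.T (cut (P.high (2 ^ J)) (h n)) z‖) := hcon
      rw [not_or, not_le, not_le, sub_zero] at hcon'
      linarith [norm_add_le (P.ev (2 ^ J) z (h n)) (P.T (cut (P.high (2 ^ J)) (h n)) z)]
    refine (measure_mono_ae hsub).trans ((measure_union_le _ _).trans ?_)
    rw [← ENNReal.add_halves δ]
    refine add_le_add hn (((hνle _).trans (volume_le_norm_le (half_pos hε) ?_)).trans hJ)
    refine (P.norm_T_cut_high_le (by positivity) (h n)).trans ?_
    gcongr
    exact hb n
  obtain ⟨φ, hφ, hlim⟩ := key.exists_seq_tendsto_ae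
  exact ⟨φ, hφ, hac.ae_le hlim⟩

end Params

/-! ### The Brezis–Lieb lemma -/

/-- If `‖b‖ ≤ η * ‖a‖`, continuity of the power at `1` gives the first term. Otherwise both `‖a‖`
and `‖a + b‖` are controlled by `‖b‖`. -/
theorem exists_abs_rpow_sub_le {q ε : ℝ} (hq : 0 < q) (hε : 0 < ε) :
    ∃ C, 0 ≤ C ∧ ∀ a b : ℂ, |‖a + b‖ ^ q - ‖a‖ ^ q| ≤ ε * ‖a‖ ^ q + C * ‖b‖ ^ q := by
  obtain ⟨η, hη0, hη1, h1, h2⟩ : ∃ η : ℝ, 0 < η ∧ η < 1 ∧ (1 + η) ^ q < 1 + ε ∧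
      1 - ε < (1 - η) ^ q := by
    have c1 : Filter.Tendsto (fun η : ℝ => (1 + η) ^ q) (nhdsWithin 0 (Set.Ioi 0)) (nhds 1) := by
      have h : Continuous fun η : ℝ => (1 + η) ^ q :=
        (continuous_const.add continuous_id).rpow_const fun _ => Or.inr hq.le
      simpa using (h.tendsto 0).mono_left (nhdsWithin_le_nhds (s := Set.Ioi 0))
    have c2 : Filter.Tendsto (fun η : ℝ => (1 - η) ^ q) (nhdsWithin 0 (Set.Ioi 0)) (nhds 1) := by
      have h : Continuous fun η : ℝ => (1 - η) ^ q :=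
        (continuous_const.sub continuous_id).rpow_const fun _ => Or.inr hq.le
      simpa using (h.tendsto 0).mono_left (nhdsWithin_le_nhds (s := Set.Ioi 0))
    obtain ⟨η, h1, h2, h3, h4⟩ := ((c1.eventually (gt_mem_nhds (by linarith : 1 < 1 + ε))).and
      ((c2.eventually (lt_mem_nhds (by linarith : 1 - ε < 1))).and
      ((eventually_nhdsWithin_of_eventually_nhds (gt_mem_nhds one_pos)).and
        self_mem_nhdsWithin))).exists
    exact ⟨η, h4, h3, h1, h2⟩
  refine ⟨(1 + η⁻¹) ^ q, by positivity, fun a b => ?_⟩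
  have ha := norm_nonneg a
  have hb := norm_nonneg b
  have hadd := norm_add_le a b
  rcases le_or_gt ‖b‖ (η * ‖a‖) with hab | hab
  · have hC : 0 ≤ (1 + η⁻¹) ^ q * ‖b‖ ^ q := by positivity
    have hlow : (1 - η) * ‖a‖ ≤ ‖a + b‖ := by
      have : ‖a‖ ≤ ‖a + b‖ + ‖b‖ := by simpa using norm_sub_le (a + b) b
      linarith
    have hupp : ‖a + b‖ ≤ (1 + η) * ‖a‖ := by linarith
    have l1 := Real.rpow_le_rpow (by nlinarith) hlow hq.le
    have l2 := Real.rpow_le_rpow (norm_nonneg _) hupp hq.le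
    rw [Real.mul_rpow (by linarith) ha] at l1 l2
    have hap : 0 ≤ ‖a‖ ^ q := by positivity
    have m1 := mul_le_mul_of_nonneg_right h1.le hap
    have m2 := mul_le_mul_of_nonneg_right h2.le hap
    rw [abs_le]
    constructor <;> linarith
  · have hab' : ‖a‖ ≤ η⁻¹ * ‖b‖ := by
      rw [inv_mul_eq_div, le_div_iff₀ hη0]; linarith
    have l1 : ‖a + b‖ ^ q ≤ (1 + η⁻¹) ^ q * ‖b‖ ^ q := by
      rw [← Real.mul_rpow (by positivity) hb]
      exact Real.rpow_le_rpow (norm_nonneg _) (by linarith) hq.le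
    have l2 : ‖a‖ ^ q ≤ (1 + η⁻¹) ^ q * ‖b‖ ^ q := by
      rw [← Real.mul_rpow (by positivity) hb]
      exact Real.rpow_le_rpow (norm_nonneg _) (by linarith) hq.le
    have h3 : 0 ≤ ‖a‖ ^ q := by positivity
    have h4 : 0 ≤ ‖a + b‖ ^ q := by positivity
    have h5 : 0 ≤ ε * ‖a‖ ^ q := by positivity
    rw [abs_le]
    constructor <;> linarith

/-- The Brezis–Lieb lemma. -/
theorem tendsto_integral_rpow_sub {α : Type*} [MeasurableSpace α] {μ : Measure α} {q B : ℝ}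
    (hq : 0 < q) {u : α → ℂ} {w : ℕ → α → ℂ} (hu : MemLp u (ENNReal.ofReal q) μ)
    (hw : ∀ n, MemLp (w n) (ENNReal.ofReal q) μ) (hB : ∀ n, ∫ x, ‖w n x‖ ^ q ∂μ ≤ B)
    (hlim : ∀ᵐ x ∂μ, Filter.Tendsto (fun n => w n x) Filter.atTop (nhds 0)) :
    Filter.Tendsto (fun n => ∫ x, ‖w n x + u x‖ ^ q ∂μ - ∫ x, ‖w n x‖ ^ q ∂μ) Filter.atTop
      (nhds (∫ x, ‖u x‖ ^ q ∂μ)) := by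
  have hint : ∀ {f : α → ℂ}, MemLp f (ENNReal.ofReal q) μ →
      Integrable (fun x => ‖f x‖ ^ q) μ := fun hf => by
    have := hf.integrable_norm_rpow (by simpa using hq) ENNReal.ofReal_ne_top
    rwa [ENNReal.toReal_ofReal hq.le] at this
  have iu := hint hu
  have iw := fun n => hint (hw n)
  have iuw := fun n => hint ((hw n).add hu)
  simp only [Pi.add_apply] at iuw
  have hB0 : 0 ≤ B := (integral_nonneg fun x => by positivity).trans (hB 0)
  rw [Metric.tendsto_atTop]
  intro ε hε
  set ε' := ε / (2 * (B + 1)) with hε'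
  have hε'0 : 0 < ε' := by positivity
  obtain ⟨C, hC0, hC⟩ := exists_abs_rpow_sub_le hq hε'0
  set D : ℕ → α → ℝ := fun n x => ‖w n x + u x‖ ^ q - ‖w n x‖ ^ q - ‖u x‖ ^ q with hD
  have iD : ∀ n, Integrable (D n) μ := fun n => ((iuw n).sub (iw n)).sub iu
  -- Subtracting `ε' * ‖w n x‖ ^ q` leaves a function dominated by `(C + 1) * ‖u x‖ ^ q`, so
  -- dominated convergence applies. By the choice of `ε'`, the subtracted part integrates to at most
  -- `ε / 2`.
  set W : ℕ → α → ℝ := fun n x => max (|D n x| - ε' * ‖w n x‖ ^ q) 0 with hW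
  have iW : ∀ n, Integrable (W n) μ := fun n =>
    ((iD n).abs.sub ((iw n).const_mul ε')).sup (integrable_zero _ _ _)
  have hWlim : Filter.Tendsto (fun n => ∫ x, W n x ∂μ) Filter.atTop (nhds 0) := by
    have := tendsto_integral_of_dominated_convergence (F := W) (f := fun _ => (0 : ℝ))
      (fun x => (C + 1) * ‖u x‖ ^ q) (fun n => (iW n).1) (iu.const_mul _)
      (fun n => Filter.Eventually.of_forall fun x => ?_) ?_
    · simpa using this
    · rw [Real.norm_of_nonneg (le_max_right _ _)]
      refine max_le ?_ (by positivity)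
      have h1 := hC (w n x) (u x)
      have h2 : |D n x| ≤ |‖w n x + u x‖ ^ q - ‖w n x‖ ^ q| + |‖u x‖ ^ q| := abs_sub _ _
      rw [abs_of_nonneg (by positivity : 0 ≤ ‖u x‖ ^ q)] at h2
      linarith
    · filter_upwards [hlim] with x hx
      have c1 : Filter.Tendsto (fun n => ‖w n x + u x‖ ^ q) Filter.atTop (nhds (‖u x‖ ^ q)) := by
        have := (hx.add_const (u x)).norm.rpow_const (p := q) (Or.inr hq.le)
        simpa using this
      have c2 : Filter.Tendsto (fun n => ‖w n x‖ ^ q) Filter.atTop (nhds 0) := by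
        have := hx.norm.rpow_const (p := q) (Or.inr hq.le)
        simpa [Real.zero_rpow hq.ne'] using this
      have c3 := (((c1.sub c2).sub_const (‖u x‖ ^ q)).abs.sub (c2.const_mul ε')).max
        (tendsto_const_nhds (x := (0 : ℝ)))
      simpa using c3
  obtain ⟨N, hN⟩ := Metric.tendsto_atTop.1 hWlim (ε / 2) (half_pos hε)
  refine ⟨N, fun n hn => ?_⟩
  have h1 : ∫ x, ‖w n x + u x‖ ^ q ∂μ - ∫ x, ‖w n x‖ ^ q ∂μ - ∫ x, ‖u x‖ ^ q ∂μ
      = ∫ x, D n x ∂μ := by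
    have i1 : Integrable (fun x => ‖w n x + u x‖ ^ q - ‖w n x‖ ^ q) μ := (iuw n).sub (iw n)
    rw [← integral_sub (iuw n) (iw n), ← integral_sub i1 iu]
  rw [Real.dist_eq, h1]
  have h2 : |∫ x, D n x ∂μ| ≤ ∫ x, (ε' * ‖w n x‖ ^ q + W n x) ∂μ := by
    refine (abs_integral_le_integral_abs).trans
      (integral_mono (iD n).abs (((iw n).const_mul ε').add (iW n)) fun x => ?_)
    have := le_max_left (|D n x| - ε' * ‖w n x‖ ^ q) 0
    simp only [hW]
    linarith
  rw [integral_add ((iw n).const_mul ε') (iW n), integral_const_mul] at h2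
  have h3 := hN n hn
  rw [Real.dist_eq, sub_zero] at h3
  have h4 : ε' * ∫ x, ‖w n x‖ ^ q ∂μ ≤ ε / 2 := by
    calc ε' * ∫ x, ‖w n x‖ ^ q ∂μ ≤ ε' * (B + 1) := by
          gcongr
          linarith [hB n]
      _ = ε / 2 := by rw [hε']; field_simp
  linarith [le_abs_self (∫ x, W n x ∂μ)]

/-! ### The best constant and its attainment -/

/-- The integral `∫ |u|^q`. -/
def lqInt (q : ℝ) (u : L2) : ℝ := ∫ z, ‖u z‖ ^ q

theorem lqInt_nonneg (q : ℝ) (u : L2) : 0 ≤ lqInt q u :=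
  integral_nonneg fun z => by positivity

theorem lqInt_smul (q : ℝ) (c : ℂ) (u : L2) : lqInt q (c • u) = ‖c‖ ^ q * lqInt q u := by
  rw [lqInt, lqInt, ← integral_const_mul]
  refine integral_congr_ae ?_
  filter_upwards [Lp.coeFn_smul c u] with z hz
  rw [hz, Pi.smul_apply, norm_smul, Real.mul_rpow (norm_nonneg _) (norm_nonneg _)]

theorem integrable_norm_rpow {α : Type*} [MeasurableSpace α] {μ : Measure α} {q : ℝ} (hq : 0 < q)
    {E : Type*} [NormedAddCommGroup E] {f : α → E} (hf : MemLp f (ENNReal.ofReal q) μ) :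
    Integrable (fun x => ‖f x‖ ^ q) μ := by
  have := hf.integrable_norm_rpow (by simpa using hq) ENNReal.ofReal_ne_top
  rwa [ENNReal.toReal_ofReal hq.le] at this

theorem eLpNorm_eq_lqInt {q : ℝ} (hq : 0 < q) {u : L2}
    (hu : MemLp u (ENNReal.ofReal q) volume) :
    eLpNorm u (ENNReal.ofReal q) volume = ENNReal.ofReal (lqInt q u ^ q⁻¹) := by
  rw [hu.eLpNorm_eq_integral_rpow_norm (by simpa using hq) ENNReal.ofReal_ne_top,
    ENNReal.toReal_ofReal hq.le, lqInt]

namespace Params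

variable (P : Params)

theorem memLp_T {q : ℝ} (hq : 2 < q) (hq6 : q < 6) (g : L2) :
    MemLp (P.T g) (ENNReal.ofReal q) volume := by
  obtain ⟨C, -, hC⟩ := P.exists_eLpNorm_T_le hq hq6
  exact ⟨Lp.aestronglyMeasurable _, (hC g).trans_lt ENNReal.ofReal_lt_top⟩

theorem exists_lqInt_T_le {q : ℝ} (hq : 2 < q) (hq6 : q < 6) :
    ∃ C, ∀ g, ‖g‖ ≤ 1 → lqInt q (P.T g) ≤ C := by
  obtain ⟨C, hC0, hC⟩ := P.exists_eLpNorm_T_le hq hq6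
  have hq0 : 0 < q := by linarith
  refine ⟨C ^ q, fun g hg => ?_⟩
  have h := hC g
  rw [eLpNorm_eq_lqInt hq0 (P.memLp_T hq hq6 g), ENNReal.ofReal_le_ofReal_iff (by positivity)] at h
  have h2 := h.trans (mul_le_of_le_one_right hC0 hg)
  have h3 := Real.rpow_le_rpow (Real.rpow_nonneg (lqInt_nonneg _ _) _) h2 hq0.le
  rwa [← Real.rpow_mul (lqInt_nonneg _ _), inv_mul_cancel₀ hq0.ne', Real.rpow_one] at h3

theorem lqInt_T_pos {q : ℝ} (hq : 2 < q) (hq6 : q < 6) {g : L2} (hg : g ≠ 0) :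
    0 < lqInt q (P.T g) := by
  have hq0 : 0 < q := by linarith
  refine (lqInt_nonneg _ _).lt_of_ne fun h0 => hg ?_
  refine P.T_injective ?_
  rw [map_zero]
  have h := eLpNorm_eq_lqInt hq0 (P.memLp_T hq hq6 g)
  rw [← h0, Real.zero_rpow (inv_ne_zero hq0.ne'), ENNReal.ofReal_zero,
    eLpNorm_eq_zero_iff (Lp.aestronglyMeasurable _) (by simpa using hq0)] at h
  exact Lp.ext (h.trans (Lp.coeFn_zero ℂ 2 volume).symm)

/-- The best constant in the embedding. -/
def best (q : ℝ) : ℝ := sSup ((fun g => lqInt q (P.T g)) '' Metric.closedBall 0 1)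

theorem bddAbove_best {q : ℝ} (hq : 2 < q) (hq6 : q < 6) :
    BddAbove ((fun g => lqInt q (P.T g)) '' Metric.closedBall 0 1) := by
  obtain ⟨C, hC⟩ := P.exists_lqInt_T_le hq hq6
  refine ⟨C, ?_⟩
  rintro _ ⟨g, hg, rfl⟩
  exact hC g (by simpa using hg)

theorem lqInt_T_smul (q : ℝ) (c : ℂ) (g : L2) :
    lqInt q (P.T (c • g)) = ‖c‖ ^ q * lqInt q (P.T g) := by
  rw [map_smul, lqInt_smul]

theorem lqInt_T_le_best {q : ℝ} (hq : 2 < q) (hq6 : q < 6) (g : L2) :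
    lqInt q (P.T g) ≤ P.best q * ‖g‖ ^ q := by
  rcases eq_or_ne g 0 with rfl | hg
  · have h := P.lqInt_T_smul q 0 0
    rw [zero_smul, norm_zero, Real.zero_rpow (by linarith), zero_mul] at h
    rw [h, norm_zero, Real.zero_rpow (by linarith), mul_zero]
  have hg0 : 0 < ‖g‖ := norm_pos_iff.2 hg
  have hn : ‖((‖g‖⁻¹ : ℝ) : ℂ)‖ = ‖g‖⁻¹ := by
    rw [Complex.norm_real, Real.norm_of_nonneg (by positivity)]
  have h1 : lqInt q (P.T (((‖g‖⁻¹ : ℝ) : ℂ) • g)) ≤ P.best q := by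
    refine le_csSup (P.bddAbove_best hq hq6) ⟨_, ?_, rfl⟩
    rw [mem_closedBall_zero_iff, norm_smul, hn, inv_mul_cancel₀ hg0.ne']
  rwa [lqInt_T_smul, hn, Real.inv_rpow hg0.le, inv_mul_le_iff₀ (by positivity), mul_comm] at h1

theorem best_pos {q : ℝ} (hq : 2 < q) (hq6 : q < 6) : 0 < P.best q := by
  have : ∃ g : L2, g ≠ 0 := by
    refine ⟨indicatorConstLp 2 (s := Metric.ball 0 1) measurableSet_ball
      measure_ball_lt_top.ne (1 : ℂ), fun h => ?_⟩
    have h1 := congrArg norm h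
    rw [norm_indicatorConstLp (by norm_num) (by norm_num), norm_zero, norm_one, one_mul] at h1
    have h2 : 0 < volume.real (Metric.ball (0 : Plane) 1) :=
      ENNReal.toReal_pos (Metric.measure_ball_pos _ _ one_pos).ne' measure_ball_lt_top.ne
    exact (Real.rpow_pos_of_pos h2 _).ne' h1
  obtain ⟨g, hg⟩ := this
  have h1 := (P.lqInt_T_pos hq hq6 hg).trans_le (P.lqInt_T_le_best hq hq6 g)
  exact pos_of_mul_pos_left h1 (by positivity)

theorem lqInt_T_mulOp_modSymbol {q : ℝ} (z : Plane) (g : L2) :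
    lqInt q (P.T (mulOp (modSymbol z) g)) = lqInt q (P.T g) := by
  rw [T_mulOp_modSymbol, lqInt, lqInt]
  rw [← (measurePreserving_add_right (volume : Measure Plane) z).integral_comp
    (measurableEmbedding_addRight z) (fun w => ‖P.T g w‖ ^ q)]
  refine integral_congr_ae ?_
  filter_upwards [Lp.coeFn_compMeasurePreserving (P.T g)
    (measurePreserving_add_right (volume : Measure Plane) z)] with w hw
  rw [hw, Function.comp_apply]

/-- A maximizing sequence with a nonzero weak limit. -/
theorem exists_maximizing_seq {q : ℝ} (hq : 2 < q) (hq6 : q < 6) :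
    ∃ (g : ℕ → L2) (g' : L2), (∀ n, ‖g n‖ ≤ 1) ∧ g' ≠ 0 ∧
      (∀ f : L2, Filter.Tendsto (fun n => inner ℂ f (g n)) Filter.atTop (nhds (inner ℂ f g'))) ∧
      Filter.Tendsto (fun n => lqInt q (P.T (g n))) Filter.atTop (nhds (P.best q)) := by
  have hq0 : 0 < q := by linarith
  have hM := P.best_pos hq hq6
  obtain ⟨a, -, ha, hmem⟩ := exists_seq_tendsto_sSup
    ((Metric.nonempty_closedBall.2 zero_le_one).image (fun g : L2 => lqInt q (P.T g)))
    (P.bddAbove_best hq hq6)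
  choose f hf1 hf2 using hmem
  have hf1' : ∀ n, ‖f n‖ ≤ 1 := fun n => by simpa using hf1 n
  have ha' : Filter.Tendsto (fun n => lqInt q (P.T (f n))) Filter.atTop (nhds (P.best q)) := by
    simp only [hf2]
    exact ha
  set ε := (P.best q / 2) ^ q⁻¹ with hε
  have hε0 : 0 < ε := by positivity
  obtain ⟨R, c, hc, hev⟩ := P.exists_le_norm_ev hq hq6 hε0
  obtain ⟨N, hN⟩ := Filter.eventually_atTop.1
    (ha'.eventually (lt_mem_nhds (half_lt_self hM)))
  -- From index `N` on the functional exceeds half its supremum, which rules out vanishing.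
  -- Modulating by `z n` then moves the concentration point to the origin.
  have hz : ∀ n, ∃ z, c ≤ ‖P.ev R z (f (n + N))‖ := fun n => by
    refine hev _ (hf1' _) ?_
    rw [eLpNorm_eq_lqInt hq0 (P.memLp_T hq hq6 _)]
    exact ENNReal.ofReal_le_ofReal
      (Real.rpow_le_rpow (by positivity) (hN (n + N) (by omega)).le (by positivity))
  choose z hz using hz
  obtain ⟨g', φ, hφ, hlim⟩ := exists_weakly_convergent_subseq
    (g := fun n => mulOp (modSymbol (z n)) (f (n + N)))
    (fun n => by rw [norm_mulOp_modSymbol]; exact hf1' _)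
  refine ⟨fun n => mulOp (modSymbol (z (φ n))) (f (φ n + N)), g', fun n => ?_, ?_, hlim, ?_⟩
  · rw [norm_mulOp_modSymbol]; exact hf1' _
  · rintro rfl
    -- The low frequency value at the origin is weakly continuous and stays at least `c` in modulus
    -- along the sequence, so the weak limit is not zero.
    obtain ⟨K, hK⟩ := P.exists_ev_eq_inner R 0
    have h1 := (hlim K).norm
    rw [inner_zero_right, norm_zero] at h1
    refine absurd (ge_of_tendsto' h1 (b := c) fun n => ?_) (not_le.2 hc)
    rw [← hK, ev_mulOp_modSymbol, zero_add]
    exact hz _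
  · simp only [lqInt_T_mulOp_modSymbol]
    exact ha'.comp ((Filter.tendsto_add_atTop_nat N).comp hφ.tendsto_atTop)

/-- The best constant in the embedding is attained. -/
theorem exists_maximizer {q : ℝ} (hq : 2 < q) (hq6 : q < 6) :
    ∃ g : L2, ‖g‖ = 1 ∧ lqInt q (P.T g) = P.best q := by
  have hq0 : 0 < q := by linarith
  have hM := P.best_pos hq hq6
  obtain ⟨g, g', hg1, hg', hweak, hmax⟩ := P.exists_maximizing_seq hq hq6
  have hw0 : ∀ f : L2, Filter.Tendsto (fun n => inner ℂ f (g n - g')) Filter.atTop (nhds 0) :=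
    fun f => by
      have := (hweak f).sub_const (inner ℂ f g')
      rw [sub_self] at this
      simpa only [inner_sub_right] using this
  have hbd : ∀ n, ‖g n - g'‖ ≤ 1 + ‖g'‖ := fun n =>
    (norm_sub_le _ _).trans (add_le_add_left (hg1 n) _)
  obtain ⟨φ, hφ, hae⟩ := P.exists_subseq_T_tendsto_ae hbd hw0
  have hmemh : ∀ n, MemLp (P.T (g (φ n) - g')) (ENNReal.ofReal q) volume :=
    fun n => P.memLp_T hq hq6 _
  have hle : ∀ n, lqInt q (P.T (g (φ n) - g')) ≤ P.best q * ‖g (φ n) - g'‖ ^ q :=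
    fun n => P.lqInt_T_le_best hq hq6 _
  have hBL := tendsto_integral_rpow_sub hq0 (B := P.best q * (1 + ‖g'‖) ^ q)
    (P.memLp_T hq hq6 g') hmemh (fun n => (hle n).trans (by
      gcongr
      exact hbd _)) hae
  have hBL' : Filter.Tendsto (fun n => lqInt q (P.T (g (φ n))) - lqInt q (P.T (g (φ n) - g')))
      Filter.atTop (nhds (lqInt q (P.T g'))) := by
    refine hBL.congr fun n => ?_
    rw [lqInt, lqInt]
    congr 1
    refine integral_congr_ae ?_
    have h1 : P.T (g (φ n)) = P.T (g (φ n) - g') + P.T g' := by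
      rw [← map_add, sub_add_cancel]
    have h2 := Lp.coeFn_add (P.T (g (φ n) - g')) (P.T g')
    rw [← h1] at h2
    filter_upwards [h2] with z hz
    rw [hz, Pi.add_apply]
  have hh : Filter.Tendsto (fun n => lqInt q (P.T (g (φ n) - g'))) Filter.atTop
      (nhds (P.best q - lqInt q (P.T g'))) := by
    refine ((hmax.comp hφ.tendsto_atTop).sub hBL').congr fun n => ?_
    simp only [Function.comp_apply]
    ring
  -- This bounds `‖g (φ n) - g'‖ ^ 2` from above by expanding the square with `‖g (φ n)‖ ≤ 1`, and
  -- it converges by weak convergence.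
  set b : ℕ → ℝ := fun n => 1 - 2 * (inner ℂ g' (g (φ n))).re + ‖g'‖ ^ 2 with hb
  have hblim : Filter.Tendsto b Filter.atTop (nhds (1 - ‖g'‖ ^ 2)) := by
    have h1 := (Complex.continuous_re.tendsto _).comp ((hweak g').comp hφ.tendsto_atTop)
    have h2 := ((h1.const_mul 2).const_sub 1).add_const (‖g'‖ ^ 2)
    have h3 : (1 : ℝ) - 2 * (inner ℂ g' g').re + ‖g'‖ ^ 2 = 1 - ‖g'‖ ^ 2 := by
      have : (inner ℂ g' g').re = ‖g'‖ ^ 2 := inner_self_eq_norm_sq (𝕜 := ℂ) g'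
      rw [this]; ring
    rw [h3] at h2
    exact h2
  have hnb : ∀ n, ‖g (φ n) - g'‖ ^ 2 ≤ b n := fun n => by
    rw [norm_sub_sq (𝕜 := ℂ)]
    have h1 : RCLike.re (inner ℂ (g (φ n)) g') = (inner ℂ g' (g (φ n))).re :=
      inner_re_symm (𝕜 := ℂ) _ _
    rw [h1]
    have h2 : ‖g (φ n)‖ ^ 2 ≤ 1 := pow_le_one₀ (norm_nonneg _) (hg1 _)
    simp only [hb]
    linarith
  have hb0 : ∀ n, 0 ≤ b n := fun n => (sq_nonneg _).trans (hnb n)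
  set s := ‖g'‖ ^ 2 with hs
  have hs0 : 0 < s := by
    have := norm_pos_iff.2 hg'
    positivity
  have hs1 : 0 ≤ 1 - s := ge_of_tendsto' hblim hb0
  have hpow : ∀ x : ℝ, 0 ≤ x → x ^ q = (x ^ 2) ^ (q / 2) := fun x hx => by
    rw [← Real.rpow_natCast, ← Real.rpow_mul hx]
    congr 1
    push_cast
    ring
  have h1 : P.best q - lqInt q (P.T g') ≤ P.best q * (1 - s) ^ (q / 2) := by
    have hlim2 := (hblim.rpow_const (p := q / 2) (Or.inr (by positivity))).const_mul (P.best q)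
    refine le_of_tendsto_of_tendsto' hh hlim2 fun n => (hle n).trans ?_
    rw [hpow _ (norm_nonneg _)]
    gcongr
    exact hnb n
  have h2 : lqInt q (P.T g') ≤ P.best q * s ^ (q / 2) := by
    rw [hs, ← hpow _ (norm_nonneg _)]
    exact P.lqInt_T_le_best hq hq6 g'
  -- For `0 < s < 1` both powers with exponent `q / 2 > 1` are strictly smaller than their bases, so
  -- `h1` and `h2` would add up to `best < best`.
  have hseq : s = 1 := by
    by_contra hne
    have hlt : s < 1 := lt_of_le_of_ne (by linarith) hne
    have e1 : s ^ (q / 2) < s := by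
      simpa using Real.rpow_lt_rpow_of_exponent_gt hs0 hlt (by linarith : 1 < q / 2)
    have e2 : (1 - s) ^ (q / 2) < 1 - s := by
      simpa using Real.rpow_lt_rpow_of_exponent_gt (by linarith : 0 < 1 - s) (by linarith)
        (by linarith : 1 < q / 2)
    nlinarith
  refine ⟨g', ?_, ?_⟩
  · rw [hseq] at hs
    exact (pow_eq_one_iff_of_nonneg (norm_nonneg _) two_ne_zero).1 hs.symm
  · rw [hseq, sub_self, Real.zero_rpow (by positivity)] at h1
    rw [hseq, Real.one_rpow] at h2
    linarith

end Params

/-! ### Differentiation of the `L^q` integral and the Euler–Lagrange equation -/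

theorem hasDerivAt_norm_add_mul_rpow {q : ℝ} (hq : 1 < q) (a b : ℂ) (t : ℝ) :
    HasDerivAt (fun t : ℝ => ‖a + t * b‖ ^ q)
      (q * (‖a + t * b‖ ^ (q - 2) * ((a + t * b) * conj b).re)) t := by
  have h1 : HasDerivAt (fun t : ℝ => a + t * b) b t := by
    simpa using ((Complex.ofRealCLM.hasDerivAt (x := t)).mul_const b).const_add a
  have h2 := (hasFDerivAt_norm_rpow (a + t * b) hq).comp_hasDerivAt t h1
  refine h2.congr_deriv ?_
  simp only [_root_.smul_apply, innerSL_apply_apply, smul_eq_mul, Complex.inner]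
  rw [mul_assoc]
  congr 2
  simp only [Complex.mul_re, Complex.conj_re, Complex.conj_im]
  ring

theorem rpow_sub_two_mul_le {q : ℝ} (hq : 2 < q) {x y s : ℝ} (hx : 0 ≤ x) (hxs : x ≤ s)
    (hy : 0 ≤ y) (hys : y ≤ s) : x ^ (q - 2) * (x * y) ≤ s ^ q := by
  have hs : 0 ≤ s := hx.trans hxs
  calc x ^ (q - 2) * (x * y) ≤ s ^ (q - 2) * (s * s) := by
        have := Real.rpow_le_rpow hx hxs (by linarith : 0 ≤ q - 2)
        gcongr
    _ = s ^ q := by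
        rw [← sq, ← Real.rpow_two, ← Real.rpow_add_of_nonneg hs (by linarith) (by norm_num)]
        congr 1
        ring

theorem norm_rpow_mul_mul_conj_le {q : ℝ} (hq : 2 < q) (a b : ℂ) :
    ‖((‖a‖ ^ (q - 2) : ℝ) : ℂ) * a * conj b‖ ≤ (‖a‖ + ‖b‖) ^ q := by
  rw [norm_mul, norm_mul, Complex.norm_real, Real.norm_of_nonneg (by positivity),
    RCLike.norm_conj, mul_assoc]
  exact rpow_sub_two_mul_le hq (norm_nonneg _) (by linarith [norm_nonneg b]) (norm_nonneg _)
    (by linarith [norm_nonneg a])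

theorem memLp_norm_add_norm {α : Type*} [MeasurableSpace α] {μ : Measure α} {q : ℝ≥0∞}
    {u w : α → ℂ} (hu : MemLp u q μ) (hw : MemLp w q μ) :
    MemLp (fun x => ‖u x‖ + ‖w x‖) q μ := hu.norm.add hw.norm

theorem integrable_add_rpow {α : Type*} [MeasurableSpace α] {μ : Measure α} {q : ℝ} (hq : 2 < q)
    {u w : α → ℂ} (hu : MemLp u (ENNReal.ofReal q) μ) (hw : MemLp w (ENNReal.ofReal q) μ) :
    Integrable (fun x => (‖u x‖ + ‖w x‖) ^ q) μ := by
  refine (integrable_norm_rpow (by linarith) (memLp_norm_add_norm hu hw)).congr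
    (Filter.Eventually.of_forall fun x => ?_)
  simp only
  rw [Real.norm_of_nonneg (by positivity)]

theorem integrable_rpow_mul_mul_conj {α : Type*} [MeasurableSpace α] {μ : Measure α} {q : ℝ}
    (hq : 2 < q) {u w : α → ℂ} (hu : MemLp u (ENNReal.ofReal q) μ)
    (hw : MemLp w (ENNReal.ofReal q) μ) :
    Integrable (fun x => ((‖u x‖ ^ (q - 2) : ℝ) : ℂ) * u x * conj (w x)) μ := by
  refine (integrable_add_rpow hq hu hw).mono' ?_
    (Filter.Eventually.of_forall fun x => norm_rpow_mul_mul_conj_le hq _ _)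
  have h1 : AEStronglyMeasurable (fun x => ‖u x‖ ^ (q - 2)) μ :=
    (Real.continuous_rpow_const (by linarith)).comp_aestronglyMeasurable hu.1.norm
  exact ((Complex.continuous_ofReal.comp_aestronglyMeasurable h1).mul hu.1).mul
    (Complex.continuous_conj.comp_aestronglyMeasurable hw.1)

/-- The derivative of `∫ |u + t w|^q` at `t = 0`. -/
theorem hasDerivAt_integral_rpow {α : Type*} [MeasurableSpace α] {μ : Measure α} {q : ℝ}
    (hq : 2 < q) {u w : α → ℂ} (hu : MemLp u (ENNReal.ofReal q) μ)
    (hw : MemLp w (ENNReal.ofReal q) μ) :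
    HasDerivAt (fun t : ℝ => ∫ x, ‖u x + t * w x‖ ^ q ∂μ)
      (q * (∫ x, ((‖u x‖ ^ (q - 2) : ℝ) : ℂ) * u x * conj (w x) ∂μ).re) 0 := by
  have hq0 : 0 < q := by linarith
  have hmeas : ∀ t : ℝ, AEStronglyMeasurable (fun x => u x + t * w x) μ :=
    fun t => hu.1.add (hw.1.const_mul (t : ℂ))
  -- For `|t| < 1` all factors of the derivative are controlled by `‖u x‖ + ‖w x‖`, whose `q`-th
  -- power is an integrable majorant.
  have key := hasDerivAt_integral_of_dominated_loc_of_deriv_le (μ := μ) (𝕜 := ℝ) (E := ℝ)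
    (x₀ := (0 : ℝ))
    (s := Metric.ball 0 1) (F := fun (t : ℝ) x => ‖u x + t * w x‖ ^ q)
    (F' := fun (t : ℝ) x => q * (‖u x + t * w x‖ ^ (q - 2) * ((u x + t * w x) * conj (w x)).re))
    (bound := fun x => q * (‖u x‖ + ‖w x‖) ^ q) (Metric.ball_mem_nhds _ one_pos)
    (Filter.Eventually.of_forall fun t =>
      (Real.continuous_rpow_const hq0.le).comp_aestronglyMeasurable (hmeas t).norm)
    (by simpa using integrable_norm_rpow hq0 hu)
    (by
      refine AEStronglyMeasurable.const_mul (AEStronglyMeasurable.mul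
        ((Real.continuous_rpow_const (by linarith)).comp_aestronglyMeasurable (hmeas 0).norm)
        (Complex.continuous_re.comp_aestronglyMeasurable ((hmeas 0).mul
          (Complex.continuous_conj.comp_aestronglyMeasurable hw.1)))) _)
    (Filter.Eventually.of_forall fun x t ht => by
      have ht1 : |t| < 1 := by simpa using ht
      have hn : ‖u x + t * w x‖ ≤ ‖u x‖ + ‖w x‖ := by
        refine (norm_add_le _ _).trans (add_le_add_right ?_ _)
        rw [norm_mul, Complex.norm_real, Real.norm_eq_abs]
        exact mul_le_of_le_one_left (norm_nonneg _) ht1.le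
      rw [norm_mul, norm_mul, Real.norm_of_nonneg hq0.le, Real.norm_of_nonneg (by positivity)]
      refine mul_le_mul_of_nonneg_left ?_ hq0.le
      refine le_trans ?_ (rpow_sub_two_mul_le hq (norm_nonneg _) hn (norm_nonneg (w x))
        (by linarith [norm_nonneg (u x)]))
      refine mul_le_mul_of_nonneg_left ?_ (by positivity)
      refine (Complex.abs_re_le_norm _).trans_eq ?_
      rw [norm_mul, RCLike.norm_conj])
    ((integrable_add_rpow hq hu hw).const_mul q)
    (Filter.Eventually.of_forall fun x t _ =>
      hasDerivAt_norm_add_mul_rpow (by linarith) (u x) (w x) t)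
  refine key.2.congr_deriv ?_
  rw [integral_const_mul]
  congr 1
  have h := integral_re (integrable_rpow_mul_mul_conj hq hu hw)
  refine Eq.trans (integral_congr_ae (Filter.Eventually.of_forall fun x => ?_)) h
  simp only [Complex.ofReal_zero, zero_mul, add_zero]
  rw [mul_assoc]
  exact (Complex.re_ofReal_mul _ _).symm

namespace Params

variable (P : Params)

/-- The nonlinear term `|u|^(q-2) u` of the equation, tested against `w`. -/
def nonlin (q : ℝ) (u w : L2) : ℂ :=
  ∫ z, ((‖u z‖ ^ (q - 2) : ℝ) : ℂ) * u z * conj (w z)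

/-- The deficit in the embedding inequality along `g + t h` is nonnegative and vanishes at `t = 0`,
so its derivative there is zero. Using the homogeneous inequality avoids a constraint on the norm.
-/
theorem euler_lagrange_re {q : ℝ} (hq : 2 < q) (hq6 : q < 6) {g : L2} (hg : ‖g‖ = 1)
    (hmax : lqInt q (P.T g) = P.best q) (h : L2) :
    P.best q * (inner ℂ h g).re = (nonlin q (P.T g) (P.T h)).re := by
  have hq0 : 0 < q := by linarith
  have d1 := hasDerivAt_integral_rpow hq (P.memLp_T hq hq6 g) (P.memLp_T hq hq6 h)
  have hF : ∀ t : ℝ, ∫ z, ‖P.T g z + t * P.T h z‖ ^ q = lqInt q (P.T (g + (t : ℂ) • h)) := by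
    intro t
    refine integral_congr_ae ?_
    rw [map_add, map_smul]
    filter_upwards [Lp.coeFn_add (P.T g) ((t : ℂ) • P.T h), Lp.coeFn_smul (t : ℂ) (P.T h)]
      with z h1 h2
    rw [h1, Pi.add_apply, h2, Pi.smul_apply, smul_eq_mul]
  simp only [hF] at d1
  set r := (inner ℂ h g).re with hr
  have hnorm : ∀ t : ℝ, ‖g + (t : ℂ) • h‖ ^ 2 = 1 + 2 * t * r + t ^ 2 * ‖h‖ ^ 2 := by
    intro t
    rw [norm_add_sq (𝕜 := ℂ), hg, inner_smul_right, norm_smul, Complex.norm_real, mul_pow,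
      Real.norm_eq_abs, sq_abs]
    have h1 : RCLike.re ((t : ℂ) * inner ℂ g h) = t * r := by
      rw [hr]
      refine (Complex.re_ofReal_mul _ _).trans ?_
      congr 1
      exact inner_re_symm (𝕜 := ℂ) _ _
    rw [h1]
    ring
  have d2 : HasDerivAt (fun t : ℝ => P.best q * ‖g + (t : ℂ) • h‖ ^ q) (P.best q * (q * r)) 0 := by
    have e : (fun t : ℝ => P.best q * ‖g + (t : ℂ) • h‖ ^ q)
        = fun t : ℝ => P.best q * (1 + 2 * t * r + t ^ 2 * ‖h‖ ^ 2) ^ (q / 2) := by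
      ext t
      rw [← hnorm, ← Real.rpow_natCast, ← Real.rpow_mul (norm_nonneg _)]
      congr 2
      push_cast
      ring
    rw [e]
    refine HasDerivAt.const_mul _ ?_
    have p1 : HasDerivAt (fun t : ℝ => 1 + 2 * t * r + t ^ 2 * ‖h‖ ^ 2) (2 * r) 0 := by
      have := (((hasDerivAt_id (0 : ℝ)).const_mul 2).mul_const r).const_add 1 |>.add
        (((hasDerivAt_id (0 : ℝ)).pow 2).mul_const (‖h‖ ^ 2))
      refine (this.congr_deriv ?_)
      simp
    have p2 := p1.rpow_const (p := q / 2) (Or.inl (by norm_num))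
    refine p2.congr_deriv ?_
    norm_num
    ring
  have hmin : IsLocalMin (fun t : ℝ => P.best q * ‖g + (t : ℂ) • h‖ ^ q -
      lqInt q (P.T (g + (t : ℂ) • h))) 0 := by
    refine Filter.Eventually.of_forall fun t => ?_
    simp only [Complex.ofReal_zero, zero_smul, add_zero, hg, Real.one_rpow, mul_one, hmax,
      sub_self]
    linarith [P.lqInt_T_le_best hq hq6 (g + (t : ℂ) • h)]
  have h0 := hmin.hasDerivAt_eq_zero (d2.sub d1)
  have h1 : q * (P.best q * r - (nonlin q (P.T g) (P.T h)).re) = 0 := by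
    rw [nonlin]
    linarith
  rcases mul_eq_zero.1 h1 with h2 | h2
  · linarith
  · linarith

theorem nonlin_smul_right (q : ℝ) (c : ℂ) (u w : L2) :
    nonlin q u (c • w) = conj c * nonlin q u w := by
  rw [nonlin, nonlin, ← integral_const_mul]
  refine integral_congr_ae ?_
  filter_upwards [Lp.coeFn_smul c w] with z hz
  rw [hz, Pi.smul_apply, smul_eq_mul, map_mul]
  ring

theorem nonlin_smul_left (q : ℝ) {c : ℝ} (hc : 0 < c) (u w : L2) :
    nonlin q ((c : ℂ) • u) w = ((c ^ (q - 2) * c : ℝ) : ℂ) * nonlin q u w := by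
  rw [nonlin, nonlin, ← integral_const_mul]
  refine integral_congr_ae ?_
  filter_upwards [Lp.coeFn_smul (c : ℂ) u] with z hz
  rw [hz, Pi.smul_apply, smul_eq_mul, norm_mul, Complex.norm_real, Real.norm_of_nonneg hc.le,
    Real.mul_rpow hc.le (norm_nonneg _)]
  push_cast
  ring

theorem nonlin_self {q : ℝ} (hq : 2 < q) (u : L2) : nonlin q u u = (lqInt q u : ℂ) := by
  rw [nonlin, lqInt, ← integral_complex_ofReal]
  refine integral_congr_ae (Filter.Eventually.of_forall fun z => ?_)
  simp only
  rw [mul_assoc, Complex.mul_conj', ← Complex.ofReal_pow, ← Complex.ofReal_mul,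
    ← Real.rpow_two, ← Real.rpow_add_of_nonneg (norm_nonneg _) (by linarith) (by norm_num),
    sub_add_cancel]

/-- Replacing `h` by `i h` in the real identity gives the imaginary part. -/
theorem euler_lagrange {q : ℝ} (hq : 2 < q) (hq6 : q < 6) {g : L2} (hg : ‖g‖ = 1)
    (hmax : lqInt q (P.T g) = P.best q) (h : L2) :
    P.best q * inner ℂ h g = nonlin q (P.T g) (P.T h) := by
  refine Complex.ext ?_ ?_
  · rw [Complex.re_ofReal_mul]
    exact P.euler_lagrange_re hq hq6 hg hmax h
  · have h1 := P.euler_lagrange_re hq hq6 hg hmax (Complex.I • h)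
    rw [inner_smul_left, map_smul, nonlin_smul_right] at h1
    simpa using h1

/-! ### The Nehari set, the equation and the scaled maximizer -/

theorem energyForm_T_self (f : L2) : (energyForm P.ω P.v (P.T f) (P.T f)).re = ‖f‖ ^ 2 := by
  rw [energyForm_T]
  exact inner_self_eq_norm_sq (𝕜 := ℂ) f

theorem nehari_T (p : ℝ) (f : L2) :
    nehari P.ω P.v p (P.T f) = ‖f‖ ^ 2 - lqInt (p + 1) (P.T f) := by
  rw [nehari, energyForm_T_self, lqInt]

theorem action_T_of_nehari_eq_zero {p : ℝ} {f : L2} (h : nehari P.ω P.v p (P.T f) = 0) :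
    action P.ω P.v p (P.T f) = (1 / 2 - 1 / (p + 1)) * ‖f‖ ^ 2 := by
  rw [nehari_T, sub_eq_zero] at h
  rw [action, energyForm_T_self, ← lqInt, ← h]
  ring

theorem isSolution_T_iff {p : ℝ} (f : L2) : IsSolution P.ω P.v p (P.T f) ↔
    ∀ h, inner ℂ h f = nonlin (p + 1) (P.T f) (P.T h) := by
  have hp : p + 1 - 2 = p - 1 := by ring
  constructor
  · intro hs h
    have := hs.2 (P.T h) (P.T_mem_X h)
    rw [energyForm_T, sub_eq_zero] at this
    rw [this, nonlin, hp]
  · intro hs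
    refine ⟨P.T_mem_X f, fun w hw => ?_⟩
    obtain ⟨h, rfl⟩ := P.exists_T_eq hw
    rw [energyForm_T, hs h, nonlin, hp, sub_self]

/-- The equation is tested against the solution itself. -/
theorem nehari_eq_zero_of_isSolution {p : ℝ} (hp : 1 < p) {f : L2}
    (h : IsSolution P.ω P.v p (P.T f)) : nehari P.ω P.v p (P.T f) = 0 := by
  have h1 := (P.isSolution_T_iff f).1 h f
  rw [nonlin_self (by linarith)] at h1
  have h2 := congrArg Complex.re h1
  rw [Complex.ofReal_re] at h2
  rw [nehari_T, ← h2, sub_eq_zero]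
  exact (inner_self_eq_norm_sq (𝕜 := ℂ) f).symm

/-- The energy norm of the ground state. -/
def groundNorm (q : ℝ) : ℝ := (P.best q)⁻¹ ^ (q - 2)⁻¹

theorem groundNorm_pos {q : ℝ} (hq : 2 < q) (hq6 : q < 6) : 0 < P.groundNorm q :=
  Real.rpow_pos_of_pos (inv_pos.2 (P.best_pos hq hq6)) _

theorem groundNorm_rpow {q : ℝ} (hq : 2 < q) (hq6 : q < 6) :
    P.groundNorm q ^ (q - 2) = (P.best q)⁻¹ := by
  rw [groundNorm, ← Real.rpow_mul (inv_pos.2 (P.best_pos hq hq6)).le,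
    inv_mul_cancel₀ (by linarith), Real.rpow_one]

/-- The constraint and the embedding give `‖f‖^2 ≤ best * ‖f‖^(p+1)`; dividing by `‖f‖^2` bounds the
norm from below. -/
theorem groundNorm_le {p : ℝ} (hp1 : 1 < p) (hp5 : p < 5) {f : L2} (hf : f ≠ 0)
    (h : nehari P.ω P.v p (P.T f) = 0) : P.groundNorm (p + 1) ≤ ‖f‖ := by
  have hq : 2 < p + 1 := by linarith
  have hq6 : p + 1 < 6 := by linarith
  have hf0 : 0 < ‖f‖ := norm_pos_iff.2 hf
  have hM := P.best_pos hq hq6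
  rw [nehari_T, sub_eq_zero] at h
  have h1 := P.lqInt_T_le_best hq hq6 f
  rw [← h] at h1
  have h2 : ‖f‖ ^ (p + 1) = ‖f‖ ^ (p + 1 - 2) * ‖f‖ ^ 2 := by
    rw [← Real.rpow_two, ← Real.rpow_add hf0, sub_add_cancel]
  rw [h2, ← mul_assoc] at h1
  have h3 : 1 ≤ P.best (p + 1) * ‖f‖ ^ (p + 1 - 2) :=
    le_of_mul_le_mul_right (by simpa using h1) (by positivity : 0 < ‖f‖ ^ 2)
  rw [← Real.rpow_le_rpow_iff (P.groundNorm_pos hq hq6).le hf0.le (by linarith : 0 < p + 1 - 2),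
    P.groundNorm_rpow hq hq6, inv_le_iff_one_le_mul₀ hM, mul_comm]
  exact h3

/-- The maximizer solves the equation up to the multiplier `best`. Scaling by `c` multiplies the
linear side by `c` and the nonlinear one by `c^(q-1)`, so the multiplier disappears when `c^(q-2) *
best = 1`, which is the defining property of `groundNorm`. -/
theorem exists_groundState {p : ℝ} (hp1 : 1 < p) (hp5 : p < 5) :
    ∃ f : L2, ‖f‖ = P.groundNorm (p + 1) ∧ IsSolution P.ω P.v p (P.T f) := by
  have hq : 2 < p + 1 := by linarith
  have hq6 : p + 1 < 6 := by linarith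
  obtain ⟨g, hg, hmax⟩ := P.exists_maximizer hq hq6
  have hpos := P.groundNorm_pos hq hq6
  refine ⟨(P.groundNorm (p + 1) : ℂ) • g, ?_, (P.isSolution_T_iff _).2 fun h => ?_⟩
  · rw [norm_smul, hg, mul_one, Complex.norm_real, Real.norm_of_nonneg hpos.le]
  · rw [map_smul, nonlin_smul_left _ hpos, ← P.euler_lagrange hq hq6 hg hmax, inner_smul_right,
      P.groundNorm_rpow hq hq6, ← mul_assoc, ← Complex.ofReal_mul]
    congr 2
    field_simp [(P.best_pos hq hq6).ne']

end Params

end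

end HalfWave

/-! ### Conclusion -/

theorem mainTheorem1 (ω v p : ℝ) (hω : 0 < ω) (hv : |v| < 1) (hp1 : 1 < p) (hp5 : p < 5) :
    (∀ u ∈ HalfWave.X, MemLp u (ENNReal.ofReal (p + 1)) (volume : Measure HalfWave.Plane)) ∧
    BddBelow (HalfWave.nehariValues ω v p) ∧
    ∃ Q : HalfWave.L2, Q ∈ HalfWave.X ∧ Q ≠ 0 ∧
      HalfWave.IsSolution ω v p Q ∧
      HalfWave.nehari ω v p Q = 0 ∧
      HalfWave.action ω v p Q = HalfWave.minAction ω v p ∧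
      ∀ u : HalfWave.L2, u ≠ 0 → HalfWave.IsSolution ω v p u →
        HalfWave.action ω v p Q ≤ HalfWave.action ω v p u := by
  let P : HalfWave.Params := ⟨ω, v, hω, hv⟩
  have hq : 2 < p + 1 := by linarith
  have hq6 : p + 1 < 6 := by linarith
  obtain ⟨f, hf, hsol⟩ := P.exists_groundState hp1 hp5
  have hf0 : f ≠ 0 := norm_pos_iff.1 (hf ▸ P.groundNorm_pos hq hq6)
  have hT0 : ∀ g, g ≠ 0 → P.T g ≠ 0 := fun g hg h => hg (P.T_injective (h.trans (map_zero _).symm))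
  have hT0' : ∀ g, P.T g ≠ 0 → g ≠ 0 := by
    rintro g hg rfl
    exact hg (map_zero _)
  have hneh := P.nehari_eq_zero_of_isSolution hp1 hsol
  have hle : ∀ g, P.T g ≠ 0 → HalfWave.nehari ω v p (P.T g) = 0 →
      HalfWave.action ω v p (P.T f) ≤ HalfWave.action ω v p (P.T g) := fun g hg hg' => by
    have h1 := P.action_T_of_nehari_eq_zero hneh
    have h2 := P.action_T_of_nehari_eq_zero hg'
    have h3 : P.groundNorm (p + 1) ≤ ‖g‖ := P.groundNorm_le hp1 hp5 (hT0' g hg) hg'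
    refine h1.le.trans (le_trans ?_ h2.ge)
    rw [← hf] at h3
    have h4 : 0 ≤ 1 / 2 - 1 / (p + 1) := by
      rw [sub_nonneg]
      exact one_div_le_one_div_of_le (by norm_num) hq.le
    gcongr
  -- The infimum is a minimum: surjectivity of `T` onto `X` lets `hle` cover all competitors.
  have hleast : IsLeast (HalfWave.nehariValues ω v p) (HalfWave.action ω v p (P.T f)) := by
    refine ⟨⟨P.T f, P.T_mem_X f, hT0 f hf0, hneh, rfl⟩, ?_⟩
    rintro _ ⟨u, hu, hu0, hun, rfl⟩
    obtain ⟨g, rfl⟩ := P.exists_T_eq hu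
    exact hle g hu0 hun
  refine ⟨fun u hu => ?_, ⟨_, hleast.2⟩, P.T f, P.T_mem_X f, hT0 f hf0, hsol, hneh,
    hleast.csInf_eq.symm, fun u hu hus => ?_⟩
  · obtain ⟨g, rfl⟩ := P.exists_T_eq hu
    exact P.memLp_T hq hq6 g
  · obtain ⟨g, rfl⟩ := P.exists_T_eq hus.1
    exact hle g hu (P.nehari_eq_zero_of_isSolution hp1 hus)
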